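/- **Setting.** Fix $\beta\ge 0$, integers $\rho\ge 1$, $\delta\ge 0$, and put $n=\rho+\delta$. Let $\Gamma_0$ be a small positively oriented circle around $0$ and $L$ an upward vertical line to the right of $\Gamma_0$. For $m\ge1$ put $\mathbb H^m(z)=\mathbf 1_{z\ge 0}\,z^{m-1}/(m-1)!$. For integers $n_1,n_2,u,v,\lambda,\kappa$ and real $x,x',y$ let $$\mathbb K^{\rm minor}(n_1,x;n_2,x')=-\mathbf 1_{n_1>n_2}2^{n_1-n_2}\mathbb H^{n_1-n_2}(x-x')+\frac{2}{(2\pi i)^2}\oint_{\Gamma_0}dz\int_L\frac{dw}{w-z}\frac{e^{-z^2+2zx}}{e^{-w^2+2wx'}}\frac{w^{n_2}}{z^{n_1}},$$ $$\mathcal K^\beta(\lambda,\kappa)=\oint_{\Gamma_0}\frac{d\zeta}{(2\pi i)^2}\int_L\frac{d\omega}{\omega-\zeta}\frac{e^{-2\zeta^2+4\beta\zeta}}{e^{-2\omega^2+4\beta\omega}}\frac{\zeta^\kappa}{\omega^{\lambda+1}},$$ $$\mathcal A^{\beta,y}_v(\kappa)=\oint_{\Gamma_0}\frac{d\zeta}{(2\pi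 i)^2}\int_L\frac{d\omega}{\zeta-\omega}\frac{e^{-\zeta^2-2y\zeta}}{e^{-2\omega^2+4\beta\omega}}\frac{\zeta^{-v}}{\omega^{\kappa+1}}+\int_L\frac{d\zeta}{2\pi i}\frac{e^{\zeta^2-2\zeta(y+2\beta)}}{\zeta^{v+\kappa+1}},$$ $$\mathcal B^{\beta,y}_u(\lambda)=\oint_{\Gamma_0}\frac{d\zeta}{(2\pi i)^2}\int_L\frac{d\omega}{\zeta-\omega}\frac{e^{-2\zeta^2+4\zeta\beta}}{e^{-\omega^2-2\omega y}}\frac{\zeta^{\lambda}}{\omega^{-u}}+\oint_{\Gamma_0}\frac{d\omega}{2\pi i}\frac{\omega^{u+\lambda}}{e^{\omega^2-2\omega(y+2\beta)}}.$$ The edge-tacnode kernel on $\mathbb Z\times\mathbb R$ is $$\mathbb K^{\rm TAC}(u_1,y_1;u_2,y_2)=\mathbb K^{\rm minor}(u_1,\beta-y_1;u_2,\beta-y_2)+2\sum_{\lambda=0}^{\max(\rho-1,\rho-1-u_2)}\Big((\mathbf 1-\mathcal K^\beta)^{-1}\mathcal A^{\beta,y_1-\beta}_{u_1}\Big)(\lambda-\rho)\;\mathcal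 B^{\beta,y_2-\beta}_{u_2}(\lambda-\rho),$$ where $\mathbf 1-\mathcal K^\beta$ is the matrix indexed by $(\lambda-\rho,\kappa-\rho)$ with $\lambda,\kappa$ in the range of the sum. Let $D=\det(\mathbf 1-\mathcal K^\beta)_{[-1,-\rho]}$ be the $\rho\times\rho$ determinant over the indices $-\rho,\dots,-1$. The edge-tacnode process is the determinantal point process on $\mathbb Z\times\mathbb R$ (counting times Lebesgue measure) with correlation kernel $\mathbb K^{\rm TAC}$; it has $u$ particles at each level $u\ge\rho$ and $\max(\rho-u,\rho)$ at each level $u\le\rho$. Let $\mathbf x^{(n)}$ and $\mathbf y^{(n)}$ be the vectors in $\mathbb R^n$ that list, in increasing order, the particles at the levels $n$ and $-\delta$. Let $\Delta_n(\mathbf x)=\prod_{i<j}(x_j-x_i)$ and $$\rho_n^{\rm GUE}(\mathbf x)=\frac{2^{n^2/2}}{(2\pi)^{n/2}\prod_{j=1}^{n-1}j!}\,\Delta_n(\mathbf x)^2\prod_{i=1}^n e^{-x_i^2}.$$ For $x_1<\dots<x_n$, let $\mathrm{Vol}(\mathcal C_{\mathbf x})$ be the Lebesgue measure in $\mathbb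 R^{n(n-1)/2}$ of the set of all $(\mathbf x^{(n-1)},\dots,\mathbf x^{(1)})$, $\mathbf x^{(k)}\in\mathbb R^k$, with $\mathbf x\succ\mathbf x^{(n-1)}\succ\dots\succ\mathbf x^{(1)}$, where $\mathbf b\succ\mathbf a$ means $b_i\le a_i\le b_{i+1}$ for all $i$. We write $\mathbf x-\beta=(x_1-\beta,\dots,x_n-\beta)$ and similarly $\mathbf y+\beta$. For $\mathbf x$ with distinct entries let $R(z)=\prod_{k}(z-x_k+\beta)$, $\hat R_{ij}(z)=\prod_{k\ne i,j}(z-x_k+\beta)$, and let $\mathcal L$ be the $n\times n$ matrix $$\mathcal L_{ij}=(-1)^\delta\,\delta\,\frac{\hat R^{(\delta-1)}_{ij}(x_i-\beta)}{R'(x_j-\beta)}\quad(i\ne j),\qquad \mathcal L_{ii}=\frac{(-1)^\delta}{\delta+1}\,\frac{R^{(\delta+1)}(x_i-\beta)}{R'(x_i-\beta)}$$ (for $\delta=0$ the off-diagonal entries are $0$), and $$\Gamma_{\mathbf x\mathbf y}=\det\Big[\frac{(y_j-x_i)^{n-1}}{(n-1)!}-\sum_{k=1}^n\mathcal L_{ik}\,\mathbb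 H^{n+\delta}(y_j-x_k)\Big]_{1\le i,j\le n}.$$ **Theorem.** The determinant $D$ is a positive real number, and the following hold. 1. For $x_1<\dots<x_n$ and $y_1<\dots<y_n$, the $2n\times2n$ determinant of $\mathbb K^{\rm TAC}$ over the points $(-\delta,y_1),\dots,(-\delta,y_n),(n,x_1),\dots,(n,x_n)$ equals $$p(\mathbf x,\mathbf y)=\frac{\rho_n^{\rm GUE}(\mathbf x-\beta)\,\rho_n^{\rm GUE}(\mathbf y+\beta)}{D}\cdot\frac{\Gamma_{\mathbf x\mathbf y}}{\mathrm{Vol}(\mathcal C_{\mathbf x})\,\mathrm{Vol}(\mathcal C_{\mathbf y})}.$$ 2. For the edge-tacnode process, $(\mathbf x^{(n)},\mathbf y^{(n)})$ has joint density $p(\mathbf x,\mathbf y)\,d\mathbf x\,d\mathbf y$ on $\{x_1<\dots<x_n,\ y_1<\dots<y_n\}$. 3. For $\mathbf x$ with distinct entries, $\mathcal L$ has rank $\rho$. If $\delta=0$ then $\mathcal L$ is the identity matrix. If $\delta\ge1$ then $\mathcal L$ has trace $0$ and its columns sum to $0$. -/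

import Mathlib

open MeasureTheory
open scoped Real ENNReal Matrix Polynomial

noncomputable section

namespace EdgeTacnode

/-! ### Contour integrals

`Γ₀` is a small circle around `0` and `L` is an upward vertical line lying to the right of `Γ₀`.
By Cauchy's theorem nothing below depends on the radius and the abscissa, as long as
`0 < radius < abscissa`; we take radius `1/2` and abscissa `1`. -/

/-- `∮_{Γ₀} f(z) dz`, counterclockwise. -/
def loopInt (f : ℂ → ℂ) : ℂ := ∮ z in C(0, 1 / 2), f z

/-- `∫_L f(w) dw` along the vertical line `Re w = 1`, upwards. -/
def lineInt (f : ℂ → ℂ) : ℂ := ∫ t : ℝ, f (1 + t * Complex.I) * Complex.I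

/-- `2πi`. -/
def twoPiI : ℂ := 2 * π * Complex.I

/-! ### The kernels -/

/-- `ℍ^m(z) = 1_{z ≥ 0} z^{m-1} / (m-1)!`, used for `m ≥ 1`. -/
def heaviside (m : ℕ) (z : ℝ) : ℝ :=
  if 0 ≤ z then z ^ (m - 1) / ((m - 1).factorial : ℝ) else 0

/-- The GUE-minor kernel `𝕂^minor(n, x; n', x')` for levels `n, n' ∈ ℤ`. -/
def minorKernel (n : ℤ) (x : ℝ) (n' : ℤ) (x' : ℝ) : ℂ :=
  -(if n' < n then (2 : ℂ) ^ (n - n') * (heaviside (n - n').toNat (x - x') : ℂ) else 0)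
  + 2 / twoPiI ^ 2 * loopInt fun z => lineInt fun w =>
      1 / (w - z) *
        (Complex.exp (-z ^ 2 + 2 * z * x) / Complex.exp (-w ^ 2 + 2 * w * x')) *
        (w ^ n' / z ^ n)

/-- The kernel `𝒦^β(l, k)`, for `l, k ∈ ℤ`. -/
def kernelK (β : ℝ) (l k : ℤ) : ℂ :=
  1 / twoPiI ^ 2 * loopInt fun ζ => lineInt fun ω =>
    1 / (ω - ζ) *
      (Complex.exp (-2 * ζ ^ 2 + 4 * β * ζ) / Complex.exp (-2 * ω ^ 2 + 4 * β * ω)) *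
      (ζ ^ k / ω ^ (l + 1))

/-- The function `𝒜^{β,y}_v(k)`. -/
def funA (β y : ℝ) (v k : ℤ) : ℂ :=
  1 / twoPiI ^ 2 * (loopInt fun ζ => lineInt fun ω =>
    1 / (ζ - ω) *
      (Complex.exp (-ζ ^ 2 - 2 * y * ζ) / Complex.exp (-2 * ω ^ 2 + 4 * β * ω)) *
      (ζ ^ (-v) / ω ^ (k + 1)))
  + 1 / twoPiI * lineInt fun ζ =>
      Complex.exp (ζ ^ 2 - 2 * ζ * (y + 2 * β)) / ζ ^ (v + k + 1)

/-- The function `ℬ^{β,y}_u(l)`. -/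
def funB (β y : ℝ) (u l : ℤ) : ℂ :=
  1 / twoPiI ^ 2 * (loopInt fun ζ => lineInt fun ω =>
    1 / (ζ - ω) *
      (Complex.exp (-2 * ζ ^ 2 + 4 * ζ * β) / Complex.exp (-ω ^ 2 - 2 * ω * y)) *
      (ζ ^ l / ω ^ (-u)))
  + 1 / twoPiI * loopInt fun ω =>
      ω ^ (u + l) / Complex.exp (ω ^ 2 - 2 * ω * (y + 2 * β))

/-- The `N × N` matrix `(𝒦^β(l - ρ, k - ρ))_{0 ≤ l, k < N}`. -/
def matK (β : ℝ) (ρ N : ℕ) : Matrix (Fin N) (Fin N) ℂ :=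
  Matrix.of fun l k => kernelK β ((l : ℤ) - ρ) ((k : ℤ) - ρ)

/-- The determinant `det(1 - 𝒦^β)_{[-1,-ρ]}`. -/
def fredholmDet (β : ℝ) (ρ : ℕ) : ℂ := (1 - matK β ρ ρ).det

/-- The edge-tacnode kernel `𝕂^TAC_{β,ρ}(u₁, y₁; u₂, y₂)`:
`𝕂^minor(u₁, β - y₁; u₂, β - y₂) +
2 ∑_{l=0}^{max(ρ-1, ρ-1-u₂)} ((1 - 𝒦^β(·-ρ,·-ρ))⁻¹ 𝒜^{β,y₁-β}_{u₁})(l-ρ) ℬ^{β,y₂-β}_{u₂}(l-ρ)`.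
For `k ≥ 0` and all `l` one has `𝒦^β(l, k) = 0`, so the resolvent is block lower triangular and
its entries with `0 ≤ l, k < N`, `N ≥ ρ`, form the inverse of the truncated `N × N` matrix; also
`ℬ^{β,y}_{u}(l - ρ) = 0` for `l ≥ max(ρ, ρ - u)`, so the sum is the full `ℓ²(-ρ, …, ∞)`
inner product. -/
def tacnodeKernel (β : ℝ) (ρ : ℕ) (u₁ : ℤ) (y₁ : ℝ) (u₂ : ℤ) (y₂ : ℝ) : ℂ :=
  let N : ℕ := max ρ ((ρ : ℤ) - u₂).toNat
  minorKernel u₁ (β - y₁) u₂ (β - y₂)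
  + 2 * ∑ l : Fin N,
      ((1 - matK β ρ N)⁻¹ *ᵥ fun k : Fin N => funA β (y₁ - β) u₁ ((k : ℤ) - ρ)) l
        * funB β (y₂ - β) u₂ ((l : ℤ) - ρ)

/-- The matrix `(𝕂^TAC(u_i, z_i; u_j, z_j))_{i,j}` of a family of space points `z_i` at
levels `u_i`. -/
def tacnodeMatrix {ι : Type*} (β : ℝ) (ρ : ℕ) (u : ι → ℤ) (z : ι → ℝ) : Matrix ι ι ℂ :=
  Matrix.of fun i j => tacnodeKernel β ρ (u i) (z i) (u j) (z j)

/-! ### The edge-tacnode process -/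

/-- The number of particles at level `u`: it is `u` for `u ≥ ρ`, and `max (ρ - u) ρ` for
`u ≤ ρ`. -/
def levelSize (ρ : ℕ) (u : ℤ) : ℕ :=
  if (ρ : ℤ) ≤ u then u.toNat else (max ((ρ : ℤ) - u) ρ).toNat

theorem levelSize_upper {n ρ δ : ℕ} (h : n = ρ + δ) : levelSize ρ (n : ℤ) = n := by
  unfold levelSize
  split_ifs <;> omega

theorem levelSize_lower {n ρ δ : ℕ} (hρ : 1 ≤ ρ) (h : n = ρ + δ) :
    levelSize ρ (-(δ : ℤ)) = n := by
  unfold levelSize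
  split_ifs <;> omega

/-- `Z` is an edge-tacnode process on the probability space `(Ω, μ)`: a family of random vectors
`Z u`, `u ∈ ℤ`, listing in increasing order the particles at level `u`, which form a
determinantal point process on `ℤ × ℝ` (with counting times Lebesgue measure) with correlation
kernel `𝕂^TAC_{β,ρ}`. That is, for all `m` and all levels `u₁, …, u_m`, the correlation function
of `m` distinct particles at these levels is `det(𝕂^TAC(u_i, z_i; u_j, z_j))_{i,j}`. -/
structure IsEdgeTacnodeProcess {Ω : Type*} [MeasurableSpace Ω] (β : ℝ) (ρ : ℕ) (μ : Measure Ω)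
    (Z : (u : ℤ) → Ω → Fin (levelSize ρ u) → ℝ) : Prop where
  measurable : ∀ u, Measurable (Z u)
  ordered : ∀ u, ∀ᵐ ω ∂μ, Monotone (Z u ω)
  det_nonneg : ∀ (m : ℕ) (u : Fin m → ℤ), ∀ᵐ z : Fin m → ℝ,
    (tacnodeMatrix β ρ u z).det.im = 0 ∧ 0 ≤ (tacnodeMatrix β ρ u z).det.re
  correlation : ∀ (m : ℕ) (u : Fin m → ℤ) (f : (Fin m → ℝ) → ℝ≥0∞), Measurable f →
    ∫⁻ ω, (∑ i : (k : Fin m) → Fin (levelSize ρ (u k)),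
        open Classical in
        if Function.Injective (fun k => (⟨u k, i k⟩ : (v : ℤ) × Fin (levelSize ρ v)))
        then f (fun k => Z (u k) ω (i k)) else 0) ∂μ
      = ∫⁻ z : Fin m → ℝ, f z * ENNReal.ofReal (tacnodeMatrix β ρ u z).det.re

/-! ### The GUE density and the interlacing cone -/

/-- `ρ_n^GUE(x) = c_n Δ_n(x)² ∏ e^{-x_i²}`,
`c_n = 2^{n²/2} / ((2π)^{n/2} ∏_{j=1}^{n-1} j!)`. -/
def gueDensity {n : ℕ} (x : Fin n → ℝ) : ℝ :=
  (2 : ℝ) ^ ((n : ℝ) ^ 2 / 2) /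
      ((2 * π) ^ ((n : ℝ) / 2) * ∏ j ∈ Finset.Icc 1 (n - 1), (j.factorial : ℝ)) *
    (Matrix.vandermonde x).det ^ 2 * ∏ i, Real.exp (-(x i) ^ 2)

/-- The interlacing `b ≻ a` of `a = (a₁, …, a_p)` and `b = (b₁, …, b_{p+1})`, both in increasing
order: `b_i ≤ a_i ≤ b_{i+1}` for all `i`. -/
def Interlaces {p q : ℕ} (a : Fin p → ℝ) (b : Fin q → ℝ) : Prop :=
  ∀ (i : Fin p) (j : Fin q),
    ((j : ℕ) = i → b j ≤ a i) ∧ ((j : ℕ) = i + 1 → a i ≤ b j)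

/-- The cone `𝒞_x` of all `(x^{(1)}, …, x^{(n-1)})`, `x^{(k)} ∈ ℝ^k`, with
`x ≻ x^{(n-1)} ≻ ⋯ ≻ x^{(1)}`. The component with index `k` is `x^{(k+1)}`. -/
def cone {n : ℕ} (x : Fin n → ℝ) : Set ((k : Fin (n - 1)) → Fin ((k : ℕ) + 1) → ℝ) :=
  {T | (∀ k l : Fin (n - 1), (l : ℕ) = k + 1 → Interlaces (T k) (T l)) ∧
    ∀ k : Fin (n - 1), (k : ℕ) + 2 = n → Interlaces (T k) x}

/-- `Vol(𝒞_x)`, the Lebesgue measure of the cone in `ℝ^{n(n-1)/2}`. -/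
def coneVol {n : ℕ} (x : Fin n → ℝ) : ℝ := (volume (cone x)).toReal

/-! ### The matrix `ℒ` and `Γ_{xy}` -/

/-- `R(z) = ∏_k (z - x_k + β)`. -/
def polyR {n : ℕ} (β : ℝ) (x : Fin n → ℝ) : ℝ[X] :=
  ∏ k, (Polynomial.X - Polynomial.C (x k) + Polynomial.C β)

/-- `R̂_{ij}(z) = ∏_{k ≠ i, j} (z - x_k + β)`. -/
def polyRhat {n : ℕ} (β : ℝ) (x : Fin n → ℝ) (i j : Fin n) : ℝ[X] :=
  ∏ k ∈ Finset.univ.filter (fun k => k ≠ i ∧ k ≠ j),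
    (Polynomial.X - Polynomial.C (x k) + Polynomial.C β)

/-- The matrix `ℒ`. For `δ = 0` the off-diagonal entries are `0` because of the factor `δ`. -/
def matL {n : ℕ} (β : ℝ) (δ : ℕ) (x : Fin n → ℝ) : Matrix (Fin n) (Fin n) ℝ :=
  Matrix.of fun i j =>
    if i = j then
      (-1) ^ δ / ((δ : ℝ) + 1) *
        ((Polynomial.derivative^[δ + 1] (polyR β x)).eval (x i - β) /
          (Polynomial.derivative (polyR β x)).eval (x i - β))
    else
      (-1) ^ δ * (δ : ℝ) *
        ((Polynomial.derivative^[δ - 1] (polyRhat β x i j)).eval (x i - β) /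
          (Polynomial.derivative (polyR β x)).eval (x j - β))

/-- `Γ_{xy} = det[(y_j - x_i)^{n-1} / (n-1)! - ∑_k ℒ_{ik} ℍ^{n+δ}(y_j - x_k)]_{i,j}`. -/
def gammaXY {n : ℕ} (β : ℝ) (δ : ℕ) (x y : Fin n → ℝ) : ℝ :=
  (Matrix.of fun i j : Fin n =>
    (y j - x i) ^ (n - 1) / ((n - 1).factorial : ℝ)
      - ∑ k, matL β δ x i k * heaviside (n + δ) (y j - x k)).det

/-- `ρ_n^GUE(x - β) ρ_n^GUE(y + β) / D · Γ_{xy} / (Vol(𝒞_x) Vol(𝒞_y))`. -/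
def jointDensity {n : ℕ} (β : ℝ) (δ : ℕ) (D : ℝ) (x y : Fin n → ℝ) : ℝ :=
  gueDensity (fun i => x i - β) * gueDensity (fun i => y i + β) / D *
    (gammaXY β δ x y / (coneVol x * coneVol y))

end EdgeTacnode

end

open EdgeTacnode

/-!
The line integrals of `exp (a w² + b w)` against integer powers of `w` and the Taylor coefficients of
`exp (a z² + b z)` are the only transcendental quantities in the kernel: expanding `1 / (w - z)` in
powers of `z / w` turns each double contour integral into a finite sum of products of the two
(`loopInt_lineInt`).

**Positivity.** By this expansion `1 - 𝒦^β` is a unitriangular Toeplitz matrix times the matrix with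
entries (Taylor coefficient) - (line integral) (`one_sub_matK`). Since `w ^ (-l - 1)` is the Laplace
transform of `s ^ l / l!`, the line integral is the moment of order `l` on the positive half-line of a
Hermite polynomial times a Gaussian, while the Taylor coefficient is the moment on the whole line
(`gaussCoeff_sub_gaussLine`). What remains is the moment on the negative half-line, and the
determinant is, up to positive factors, that of the Gram matrix of the monomials (`moment_det_pos`).

**The kernel determinant.** At the level `-δ ≤ 0` the minor kernel has no pole inside the loop and
vanishes in the first block row. So the resolvent factors out (`det_blocks`): the determinant is
`2 ^ n det 𝒜 / D`, with `𝒜` a Hermite-Gaussian Vandermonde matrix, times the determinant of the block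
matrix with rows `ℬ` and the minor kernel at level `n`. Up to a unitriangular Toeplitz factor, the
rows of `ℬ` are `(E - P J_y, - P J_x)`, where `P` is a shift, `J` consists of line integrals and `E` of
Taylor coefficients of `exp (z² - 2 (β - y_j) z)` (`funB_lower`, `funB_upper`). The rows of the minor
kernel are `2 h (J_y, J_x)` minus a multiple of the Heaviside block, where `h` is the matrix of Hermite
polynomials at the points `β - x_i`. In the Lagrange basis at the nodes `x_i - β` the matrix `ℒ` is the
operator `(-d/dz)^δ` (`matL_eq_basis`), which lowers the index of Hermite polynomials by `δ`; this is
`ℒ h = 2 ^ δ h P` (`matL_mul_hermiteMat`). It allows to eliminate the line integrals `J_y`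
(`det_eliminate`). The block `h E` that is left is a Cauchy product of two Gaussian exponentials whose
quadratic parts cancel, so that its entries are proportional to `(y_j - x_i) ^ (n - 1) / (n - 1)!`, and
the Heaviside block appears multiplied by `ℒ`: this is `Γ_xy`. The remaining factor `det J_x` is
again a Hermite-Gaussian Vandermonde determinant.

**The density.** The volume of the interlacing cone is `Δ_n(x) / ∏ j!` (`volume_cone`), by induction:
the integral of a Vandermonde determinant over interlacing vectors is again one. This converts the two
Vandermonde determinants into the GUE densities divided by cone volumes. For the process, the
correlation function of `2n` points, `n` at each level, is tested against an indicator supported on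
increasing configurations; the particles of a level are almost surely distinct, and only one
labelling is increasing, so that the expectation of the sum is the law of the two vectors
(`joint_density`).

**The matrix `ℒ`.** Its rank, its trace and its value for `δ = 0` are read off from
`ℒ = 2 ^ δ h P h⁻¹`, and its columns sum to zero for `δ ≥ 1` because derivatives of constants vanish.
-/

noncomputable section

namespace EdgeTacnode

/-! ### Taylor coefficients of Gaussian exponentials -/

/-- The entire function `z ↦ exp (a z² + b z)`. -/
def gaussExp (a b : ℝ) (z : ℂ) : ℂ := Complex.exp (a * z ^ 2 + b * z)

/-- The coefficient of `z ^ j` in `exp (a z² + b z)`. -/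
def gaussCoeff (a b : ℝ) (j : ℕ) : ℂ := iteratedDeriv j (gaussExp a b) 0 / (j.factorial : ℂ)

theorem contDiff_gaussExp (a b : ℝ) {n : WithTop ℕ∞} : ContDiff ℂ n (gaussExp a b) := by
  unfold gaussExp
  fun_prop

theorem differentiable_gaussExp (a b : ℝ) : Differentiable ℂ (gaussExp a b) :=
  (contDiff_gaussExp a b (n := 1)).differentiable (by norm_num)

theorem continuous_gaussExp (a b : ℝ) : Continuous (gaussExp a b) :=
  (differentiable_gaussExp a b).continuous

theorem gaussExp_mul (a b a' b' : ℝ) (z : ℂ) :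
    gaussExp a b z * gaussExp a' b' z = gaussExp (a + a') (b + b') z := by
  simp only [gaussExp, ← Complex.exp_add]
  push_cast
  ring_nf

@[simp] theorem gaussCoeff_zero (a b : ℝ) : gaussCoeff a b 0 = 1 := by
  simp [gaussCoeff, gaussExp]

/-- The Cauchy product of two Gaussian exponentials. -/
theorem gaussCoeff_add (a b a' b' : ℝ) (n : ℕ) :
    gaussCoeff (a + a') (b + b') n
      = ∑ i ∈ Finset.range (n + 1), gaussCoeff a b i * gaussCoeff a' b' (n - i) := by
  have h : gaussExp (a + a') (b + b') = fun z => gaussExp a b z * gaussExp a' b' z := by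
    funext z
    rw [gaussExp_mul]
  unfold gaussCoeff
  rw [h, iteratedDeriv_fun_mul (contDiff_gaussExp a b).contDiffAt
    (contDiff_gaussExp a' b').contDiffAt, Finset.sum_div]
  refine Finset.sum_congr rfl fun i hi => ?_
  have hi' : i ≤ n := Nat.lt_succ_iff.mp (Finset.mem_range.mp hi)
  have hc : ((n.choose i : ℕ) : ℂ) * (i.factorial : ℂ) * ((n - i).factorial : ℂ)
      = (n.factorial : ℂ) := by
    exact_mod_cast Nat.choose_mul_factorial_mul_factorial hi'
  have h1 : (i.factorial : ℂ) ≠ 0 := by exact_mod_cast i.factorial_ne_zero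
  have h2 : ((n - i).factorial : ℂ) ≠ 0 := by exact_mod_cast (n - i).factorial_ne_zero
  have h3 : (n.factorial : ℂ) ≠ 0 := by exact_mod_cast n.factorial_ne_zero
  have h4 : (n.choose i : ℂ) ≠ 0 := by exact_mod_cast (Nat.choose_pos hi').ne'
  rw [← hc]
  field_simp

theorem hasDerivAt_gaussExp (a b : ℝ) (z : ℂ) :
    HasDerivAt (gaussExp a b) ((2 * a * z + b) * gaussExp a b z) z := by
  have h : HasDerivAt (fun z : ℂ => (a : ℂ) * z ^ 2 + b * z) (2 * a * z + b) z := by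
    refine (((hasDerivAt_pow 2 z).const_mul (a : ℂ)).add
      ((hasDerivAt_id z).const_mul (b : ℂ))).congr_deriv ?_
    push_cast
    ring
  have h2 := h.cexp
  unfold gaussExp
  rw [mul_comm]
  exact h2

theorem iteratedDeriv_linear (c d : ℂ) (i : ℕ) :
    iteratedDeriv (i + 2) (fun z : ℂ => c * z + d) = 0 := by
  have h1 : deriv (fun z : ℂ => c * z + d) = fun _ => c := by
    funext z
    simp
  have h2 : deriv (fun _ : ℂ => c) = fun _ => 0 := by
    funext z
    simp
  rw [iteratedDeriv_succ', h1, iteratedDeriv_succ', h2]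
  funext z
  simp

theorem gaussCoeff_one (a b : ℝ) : gaussCoeff a b 1 = b := by
  have h := (hasDerivAt_gaussExp a b 0).deriv
  simp [gaussCoeff, iteratedDeriv_one, h, gaussExp]

/-- The recurrence coming from the differential equation `F' = (2 a z + b) F`. -/
theorem gaussCoeff_succ_succ (a b : ℝ) (k : ℕ) :
    ((k : ℂ) + 2) * gaussCoeff a b (k + 2) = b * gaussCoeff a b (k + 1)
      + 2 * a * gaussCoeff a b k := by
  have hd : deriv (gaussExp a b) = fun z => (2 * a * z + b) * gaussExp a b z := by
    funext z
    exact (hasDerivAt_gaussExp a b z).deriv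
  have hl : deriv (fun z : ℂ => 2 * (a : ℂ) * z + b) 0 = 2 * a := by
    simp
  have hsm : ∀ n : ℕ, ContDiffAt ℂ n (fun z : ℂ => 2 * (a : ℂ) * z + b) 0 := fun n => by
    fun_prop
  have key : iteratedDeriv (k + 2) (gaussExp a b) 0
      = b * iteratedDeriv (k + 1) (gaussExp a b) 0
        + ((k : ℂ) + 1) * (2 * a) * iteratedDeriv k (gaussExp a b) 0 := by
    rw [iteratedDeriv_succ', hd, iteratedDeriv_fun_mul (hsm _) (contDiff_gaussExp a b).contDiffAt,
      Finset.sum_range_succ', Finset.sum_range_succ', Finset.sum_eq_zero]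
    · simp only [zero_add, iteratedDeriv_one, hl, iteratedDeriv_zero]
      simp
      ring
    · intro i _
      rw [iteratedDeriv_linear]
      simp
  have hf : ((k + 2).factorial : ℂ) = ((k : ℂ) + 2) * (((k : ℂ) + 1) * (k.factorial : ℂ)) := by
    rw [Nat.factorial_succ, Nat.factorial_succ]; push_cast; ring
  have hf1 : ((k + 1).factorial : ℂ) = ((k : ℂ) + 1) * (k.factorial : ℂ) := by
    rw [Nat.factorial_succ]; push_cast; ring
  have h0 : (k.factorial : ℂ) ≠ 0 := by exact_mod_cast k.factorial_ne_zero
  have h1 : ((k : ℂ) + 1) ≠ 0 := by exact_mod_cast k.succ_ne_zero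
  have h2 : ((k : ℂ) + 2) ≠ 0 := by exact_mod_cast (k + 1).succ_ne_zero
  unfold gaussCoeff
  rw [key, hf, hf1]
  field_simp

theorem gaussCoeff_zero_left (b : ℝ) (n : ℕ) :
    gaussCoeff 0 b n = (b : ℂ) ^ n / (n.factorial : ℂ) := by
  have : gaussExp 0 b = fun z => Complex.exp ((b : ℂ) * z) := by
    funext z
    simp [gaussExp]
  unfold gaussCoeff
  rw [this, iteratedDeriv_cexp_const_mul]
  simp

/-! ### Contour integrals of Gaussian exponentials -/

theorem twoPiI_ne_zero : twoPiI ≠ 0 := by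
  simp [twoPiI, Real.pi_ne_zero]

theorem sphere_ne_zero {z : ℂ} (hz : z ∈ Metric.sphere (0 : ℂ) (1 / 2)) : z ≠ 0 := by
  rintro rfl
  simp at hz

theorem loopInt_congr {f g : ℂ → ℂ} (h : ∀ z : ℂ, ‖z‖ = 1 / 2 → f z = g z) :
    loopInt f = loopInt g :=
  circleIntegral.integral_congr (by norm_num) fun z hz => h z (by simpa using hz)

theorem lineInt_congr {f g : ℂ → ℂ} (h : ∀ w : ℂ, w.re = 1 → f w = g w) :
    lineInt f = lineInt g := by
  unfold lineInt
  congr 1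
  funext t
  rw [h _ (by simp)]

theorem loopInt_gaussExp_of_neg (a b : ℝ) (j : ℕ) :
    loopInt (fun z => gaussExp a b z * z ^ (-((j : ℤ) + 1))) = twoPiI * gaussCoeff a b j := by
  have h := (differentiable_gaussExp a b).diffContOnCl
    (s := Metric.ball (0 : ℂ) (1 / 2))
    |>.circleIntegral_one_div_sub_center_pow_smul (by norm_num) j
  rw [gaussCoeff, twoPiI]
  have h2 : loopInt (fun z => gaussExp a b z * z ^ (-((j : ℤ) + 1)))
      = ∮ (z : ℂ) in C(0, 1 / 2), (1 / (z - 0) ^ (j + 1)) • gaussExp a b z := by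
    refine loopInt_congr fun z _ => ?_
    rw [zpow_neg, sub_zero, smul_eq_mul, one_div, mul_comm]
    norm_cast
  rw [h2, h, smul_eq_mul]
  ring

theorem loopInt_eq_zero {f : ℂ → ℂ} (hf : DifferentiableOn ℂ f (Metric.closedBall 0 (1 / 2))) :
    loopInt f = 0 :=
  Complex.circleIntegral_eq_zero_of_differentiable_on_off_countable (by norm_num)
    Set.countable_empty hf.continuousOn fun z hz =>
      (hf z (Metric.ball_subset_closedBall hz.1)).differentiableAt
        (Metric.closedBall_mem_nhds_of_mem hz.1)

theorem loopInt_gaussExp_of_nonneg (a b : ℝ) (j : ℕ) :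
    loopInt (fun z => gaussExp a b z * z ^ (j : ℤ)) = 0 := by
  simp only [zpow_natCast]
  exact loopInt_eq_zero
    ((differentiable_gaussExp a b).mul (differentiable_pow j)).differentiableOn

/-- `(2πi)⁻¹ ∫_L exp (a w² + b w) w ^ p dw`, for an integer `p`; the integral converges
when `a > 0`. -/
def gaussLine (a b : ℝ) (p : ℤ) : ℂ :=
  1 / twoPiI * lineInt fun w => gaussExp a b w * w ^ p

theorem line_ne_zero {w : ℂ} (hw : w.re = 1) : w ≠ 0 := by
  rintro rfl
  simp at hw

theorem one_le_norm_line {w : ℂ} (hw : w.re = 1) : 1 ≤ ‖w‖ := by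
  simpa [hw] using Complex.abs_re_le_norm w

theorem norm_gaussExp_line (a b t : ℝ) :
    ‖gaussExp a b (1 + t * Complex.I)‖ = Real.exp (a + b - a * t ^ 2) := by
  rw [gaussExp, Complex.norm_exp]
  congr 1
  have : (a : ℂ) * (1 + t * Complex.I) ^ 2 + b * (1 + t * Complex.I)
      = ((a + b - a * t ^ 2 : ℝ) : ℂ) + ((2 * a * t + b * t : ℝ) : ℂ) * Complex.I := by
    push_cast
    linear_combination (a : ℂ) * t ^ 2 * Complex.I_sq
  rw [this, Complex.add_re, Complex.ofReal_re, Complex.re_ofReal_mul, Complex.I_re, mul_zero,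
    add_zero]

theorem continuous_line : Continuous fun t : ℝ => (1 + t * Complex.I : ℂ) := by fun_prop

theorem line_re (t : ℝ) : (1 + t * Complex.I : ℂ).re = 1 := by simp

theorem continuous_gaussExp_line (a b : ℝ) (p : ℤ) :
    Continuous fun t : ℝ => gaussExp a b (1 + t * Complex.I) * (1 + t * Complex.I) ^ p :=
  ((continuous_gaussExp a b).comp continuous_line).mul
    (continuous_line.zpow₀ p fun t => Or.inl (line_ne_zero (line_re t)))

theorem integrable_gaussExp_line {a : ℝ} (ha : 0 < a) (b : ℝ) (p : ℤ) :
    Integrable fun t : ℝ => gaussExp a b (1 + t * Complex.I) * (1 + t * Complex.I) ^ p := by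
  have key : ∀ c : ℝ, Integrable fun t : ℝ => Real.exp (-a * t ^ 2 + c * t + (a + b)) := by
    intro c
    have h := (integrable_cexp_quadratic (b := (a : ℂ)) (by simpa using ha) c ((a + b : ℝ) : ℂ)).norm
    refine h.congr (Filter.Eventually.of_forall fun t => ?_)
    simp only [Complex.norm_exp]
    congr 1
    norm_cast
  set q := p.toNat with hq
  refine (((key 1).add (key (-1))).const_mul ((q.factorial : ℝ) * Real.exp 1)).mono'
    (continuous_gaussExp_line a b p).aestronglyMeasurable (Filter.Eventually.of_forall fun t => ?_)
  have h1 : ‖(1 + t * Complex.I : ℂ)‖ ≤ 1 + |t| := by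
    refine (norm_add_le _ _).trans ?_
    simp
  have h2 : ‖(1 + t * Complex.I : ℂ) ^ p‖ ≤ (q.factorial : ℝ) * Real.exp (1 + |t|) := by
    have h3 : ‖(1 + t * Complex.I : ℂ) ^ p‖ ≤ ‖(1 + t * Complex.I : ℂ)‖ ^ q := by
      rw [norm_zpow, ← zpow_natCast]
      exact zpow_le_zpow_right₀ (one_le_norm_line (line_re t)) (Int.self_le_toNat p)
    refine h3.trans ((pow_le_pow_left₀ (norm_nonneg _) h1 q).trans ?_)
    have h4 := Real.pow_div_factorial_le_exp (1 + |t|) (by positivity) q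
    rwa [div_le_iff₀ (by positivity), mul_comm] at h4
  have h5 : Real.exp |t| ≤ Real.exp t + Real.exp (-t) := by
    rcases abs_cases t with h | h <;> rw [h.1] <;> linarith [Real.exp_pos t, Real.exp_pos (-t)]
  rw [norm_mul, norm_gaussExp_line]
  calc Real.exp (a + b - a * t ^ 2) * ‖(1 + t * Complex.I : ℂ) ^ p‖
      ≤ Real.exp (a + b - a * t ^ 2) * ((q.factorial : ℝ) * (Real.exp 1 * (Real.exp t + Real.exp (-t)))) := by
        gcongr
        refine h2.trans ?_
        rw [Real.exp_add]
        gcongr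
    _ = _ := by
        simp only [Pi.add_apply]
        have e1 : Real.exp (-a * t ^ 2 + 1 * t + (a + b)) = Real.exp (a + b - a * t ^ 2) * Real.exp t := by
          rw [← Real.exp_add]; ring_nf
        have e2 : Real.exp (-a * t ^ 2 + -1 * t + (a + b))
            = Real.exp (a + b - a * t ^ 2) * Real.exp (-t) := by
          rw [← Real.exp_add]; ring_nf
        rw [e1, e2]
        ring

/-- By the geometric series in `z / w`, the loop integral of `1 / (w - z)` against a Laurent series
only sees the finitely many terms with a pole at `0`. -/
theorem loopInt_resolvent (a b : ℝ) (k : ℤ) {w : ℂ} (hw : w.re = 1) :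
    loopInt (fun z => 1 / (w - z) * (gaussExp a b z * z ^ k))
      = twoPiI * ∑ m ∈ Finset.range (-k).toNat,
          gaussCoeff a b ((-k).toNat - 1 - m) * w ^ (-(m : ℤ) - 1) := by
  set M := (-k).toNat with hM
  have hw0 := line_ne_zero hw
  have hwz : ∀ z : ℂ, ‖z‖ ≤ 1 / 2 → w - z ≠ 0 := by
    intro z hz h
    rw [sub_eq_zero] at h
    have := one_le_norm_line hw
    rw [h] at this
    linarith
  -- the geometric expansion of `1 / (w - z)` with remainder
  have hgeom : ∀ z : ℂ, ‖z‖ = 1 / 2 → 1 / (w - z) * (gaussExp a b z * z ^ k)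
      = (∑ m ∈ Finset.range M, w ^ (-(m : ℤ) - 1) * (gaussExp a b z * z ^ (k + m)))
        + 1 / (w - z) * (gaussExp a b z * (w ^ (-(M : ℤ)) * z ^ (k + M))) := by
    intro z hz
    have hz0 : z ≠ 0 := by rintro rfl; norm_num at hz
    have hne := hwz z hz.le
    clear_value M
    clear hM
    induction M with
    | zero => simp
    | succ M ih =>
      rw [Finset.sum_range_succ, ih, add_assoc]
      congr 1
      have e1 : z ^ (k + ((M + 1 : ℕ) : ℤ)) = z ^ (k + M) * z := by
        rw [← zpow_add_one₀ hz0]; push_cast; ring_nf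
      have e2 : w ^ (-(M : ℤ)) = w ^ (-(M : ℤ) - 1) * w := by
        rw [← zpow_add_one₀ hw0]; ring_nf
      have e3 : w ^ (-((M + 1 : ℕ) : ℤ)) = w ^ (-(M : ℤ) - 1) := by
        push_cast; ring_nf
      rw [e1, e2, e3]
      field_simp
      ring
  have hcz : ∀ j : ℤ, ContinuousOn (fun z : ℂ => gaussExp a b z * z ^ j)
      (Metric.sphere 0 (1 / 2)) := fun j =>
    (continuous_gaussExp a b).continuousOn.mul
      (continuousOn_id.zpow₀ j fun z hz => Or.inl (sphere_ne_zero hz))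
  have hrem : DifferentiableOn ℂ (fun z : ℂ => 1 / (w - z) *
      (gaussExp a b z * (w ^ (-(M : ℤ)) * z ^ (k + M)))) (Metric.closedBall 0 (1 / 2)) := by
    obtain ⟨q, hq⟩ : ∃ q : ℕ, k + M = q := ⟨(k + M).toNat, by omega⟩
    rw [hq]
    simp only [zpow_natCast]
    refine DifferentiableOn.mul ?_ ?_
    · refine DifferentiableOn.div (differentiableOn_const _)
        ((differentiableOn_const _).sub differentiableOn_id) fun z hz => hwz z (by simpa using hz)
    · exact ((differentiable_gaussExp a b).mul
        ((differentiable_pow q).const_mul _)).differentiableOn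
  rw [loopInt_congr hgeom, loopInt, circleIntegral.integral_add]
  · have h0 := loopInt_eq_zero hrem
    rw [loopInt] at h0
    rw [h0, add_zero, circleIntegral.integral_fun_sum, Finset.mul_sum]
    · refine Finset.sum_congr rfl fun m hm => ?_
      have hm' := Finset.mem_range.mp hm
      have h1 := loopInt_gaussExp_of_neg a b (M - 1 - m)
      have h2 : -(((M - 1 - m : ℕ) : ℤ) + 1) = k + m := by omega
      rw [h2, loopInt] at h1
      rw [circleIntegral.integral_const_mul, h1]
      ring
    · intro m _
      exact ContinuousOn.circleIntegrable (by norm_num) (continuousOn_const.mul (hcz (k + m)))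
  · refine ContinuousOn.circleIntegrable (by norm_num) ?_
    exact continuousOn_finsetSum _ fun m _ => continuousOn_const.mul (hcz (k + m))
  · exact ContinuousOn.circleIntegrable (by norm_num)
      (hrem.continuousOn.mono Metric.sphere_subset_closedBall)

theorem loopInt_lineInt_swap (a b : ℝ) (k : ℤ) {a' : ℝ} (ha' : 0 < a') (b' : ℝ) (p : ℤ) :
    loopInt (fun z => lineInt fun w =>
        1 / (w - z) * (gaussExp a b z * z ^ k) * (gaussExp a' b' w * w ^ p))
      = lineInt fun w => loopInt fun z =>
        1 / (w - z) * (gaussExp a b z * z ^ k) * (gaussExp a' b' w * w ^ p) := by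
  have hc0 : ∀ θ : ℝ, circleMap 0 (1 / 2) θ ≠ 0 := fun θ => circleMap_ne_center (by norm_num)
  have hcn : ∀ θ : ℝ, ‖circleMap 0 (1 / 2) θ‖ = 1 / 2 := fun θ => by
    simp
  set A : ℝ → ℂ := fun θ => deriv (circleMap 0 (1 / 2)) θ *
    (gaussExp a b (circleMap 0 (1 / 2) θ) * circleMap 0 (1 / 2) θ ^ k) with hA
  set B : ℝ → ℂ := fun t => gaussExp a' b' (1 + t * Complex.I) * (1 + t * Complex.I) ^ p
    * Complex.I with hB
  have hBint : Integrable B := (integrable_gaussExp_line ha' b' p).mul_const _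
  have hAc : Continuous A := by
    refine Continuous.mul ?_ (((continuous_gaussExp a b).comp (continuous_circleMap _ _)).mul
      ((continuous_circleMap _ _).zpow₀ k fun θ => Or.inl (hc0 θ)))
    have hd : deriv (circleMap 0 (1 / 2)) = fun θ => circleMap 0 (1 / 2) θ * Complex.I := by
      funext θ
      rw [deriv_circleMap]
    rw [hd]
    exact (continuous_circleMap _ _).mul continuous_const
  have hdist : ∀ θ t : ℝ, 1 / 2 ≤ ‖(1 + t * Complex.I : ℂ) - circleMap 0 (1 / 2) θ‖ := by
    intro θ t
    have h1 := norm_sub_norm_le (1 + t * Complex.I : ℂ) (circleMap 0 (1 / 2) θ)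
    have h2 := one_le_norm_line (line_re t)
    rw [hcn] at h1
    linarith
  have hint : Integrable (Function.uncurry fun θ t : ℝ =>
      1 / ((1 + t * Complex.I : ℂ) - circleMap 0 (1 / 2) θ) * (A θ * B t))
      ((volume.restrict (Set.uIoc 0 (2 * π))).prod volume) := by
    have hAint : Integrable A (volume.restrict (Set.uIoc 0 (2 * π))) :=
      (hAc.integrableOn_uIcc).mono_set Set.uIoc_subset_uIcc
    have hAB := (hAint.mul_prod hBint).norm.const_mul 2
    refine hAB.mono' ?_ (Filter.Eventually.of_forall fun q => ?_)
    · refine Continuous.aestronglyMeasurable ?_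
      refine Continuous.mul (Continuous.div continuous_const ?_ ?_) ?_
      · have := (continuous_circleMap 0 (1 / 2))
        fun_prop
      · intro q h
        have := hdist q.1 q.2
        rw [h] at this
        norm_num at this
      · have hBc : Continuous B := (continuous_gaussExp_line a' b' p).mul continuous_const
        exact (hAc.comp continuous_fst).mul (hBc.comp continuous_snd)
    · simp only [Function.uncurry]
      rw [norm_mul, norm_div, norm_one]
      gcongr
      rw [div_le_iff₀ (by linarith [hdist q.1 q.2])]
      linarith [hdist q.1 q.2]
  have hsw := intervalIntegral_integral_swap hint
  unfold loopInt lineInt circleIntegral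
  calc _ = ∫ θ in 0..2 * π, ∫ t : ℝ,
        1 / ((1 + t * Complex.I : ℂ) - circleMap 0 (1 / 2) θ) * (A θ * B t) := by
        congr 1
        funext θ
        rw [smul_eq_mul, ← integral_const_mul]
        congr 1
        funext t
        simp only [hA, hB]
        ring
    _ = _ := by
        rw [hsw]
        congr 1
        funext t
        rw [← intervalIntegral.integral_mul_const]
        congr 1
        funext θ
        simp only [hA, hB, smul_eq_mul]
        ring

/-- Evaluation of the double contour integrals by expanding `1 / (w - z)` in powers of `z / w`:
only finitely many terms have a pole inside the circle. -/
theorem loopInt_lineInt (a b : ℝ) (k : ℤ) {a' : ℝ} (ha' : 0 < a') (b' : ℝ) (p : ℤ) :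
    loopInt (fun z => lineInt fun w =>
        1 / (w - z) * (gaussExp a b z * z ^ k) * (gaussExp a' b' w * w ^ p))
      = twoPiI ^ 2 * ∑ m ∈ Finset.range (-k).toNat,
          gaussCoeff a b ((-k).toNat - 1 - m) * gaussLine a' b' (p - m - 1) := by
  rw [loopInt_lineInt_swap a b k ha' b' p]
  have h1 : ∀ w : ℂ, w.re = 1 → (loopInt fun z =>
        1 / (w - z) * (gaussExp a b z * z ^ k) * (gaussExp a' b' w * w ^ p))
      = ∑ m ∈ Finset.range (-k).toNat, twoPiI * gaussCoeff a b ((-k).toNat - 1 - m) *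
          (gaussExp a' b' w * w ^ (p - m - 1)) := by
    intro w hw
    have h2 := loopInt_resolvent a b k hw
    unfold loopInt at h2 ⊢
    have h3 : ∀ z, 1 / (w - z) * (gaussExp a b z * z ^ k) * (gaussExp a' b' w * w ^ p)
        = (gaussExp a' b' w * w ^ p) * (1 / (w - z) * (gaussExp a b z * z ^ k)) := fun z => by ring
    simp only [h3]
    rw [circleIntegral.integral_const_mul, h2, Finset.mul_sum, Finset.mul_sum]
    refine Finset.sum_congr rfl fun m _ => ?_
    have h4 : w ^ (p - m - 1) = w ^ p * w ^ (-(m : ℤ) - 1) := by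
      rw [← zpow_add₀ (line_ne_zero hw)]; ring_nf
    rw [h4]
    ring
  rw [lineInt_congr h1]
  unfold lineInt gaussLine lineInt
  simp only [Finset.sum_mul]
  rw [integral_finsetSum, Finset.mul_sum]
  · refine Finset.sum_congr rfl fun m _ => ?_
    simp only [mul_assoc]
    rw [integral_const_mul, integral_const_mul]
    have hq : ∀ c Q : ℂ, twoPiI * (c * Q) = twoPiI ^ 2 * (c * (1 / twoPiI * Q)) := by
      intro c Q
      have := twoPiI_ne_zero
      field_simp
    exact hq _ _
  · intro m _
    exact ((integrable_gaussExp_line ha' b' (p - m - 1)).const_mul _).mul_const _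

/-! ### Monic Hermite polynomials -/

/-- The monic Hermite polynomials of variance `v`:
`P₀ = 1`, `P₁ = X` and `P_{k+2} = X P_{k+1} - (k + 1) v P_k`. -/
def hermitePoly (v : ℝ) : ℕ → ℝ[X]
  | 0 => 1
  | 1 => Polynomial.X
  | (k + 2) => Polynomial.X * hermitePoly v (k + 1)
      - Polynomial.C (((k : ℝ) + 1) * v) * hermitePoly v k

theorem hermitePoly_succ_succ (v : ℝ) (k : ℕ) :
    hermitePoly v (k + 2) = Polynomial.X * hermitePoly v (k + 1)
      - Polynomial.C (((k : ℝ) + 1) * v) * hermitePoly v k := rfl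

theorem hermitePoly_monic_natDegree (v : ℝ) (k : ℕ) :
    (hermitePoly v k).Monic ∧ (hermitePoly v k).natDegree = k := by
  induction k using Nat.strong_induction_on with
  | _ k ih =>
    match k with
    | 0 => simp [hermitePoly]
    | 1 => simp [hermitePoly, Polynomial.monic_X]
    | (k + 2) =>
      obtain ⟨h1, h1'⟩ := ih (k + 1) (by omega)
      obtain ⟨h0, h0'⟩ := ih k (by omega)
      have hX : (Polynomial.X * hermitePoly v (k + 1)).Monic := Polynomial.monic_X.mul h1
      have hXd : (Polynomial.X * hermitePoly v (k + 1)).natDegree = k + 2 := by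
        rw [Polynomial.monic_X.natDegree_mul h1, h1', Polynomial.natDegree_X]
        ring
      have hlt : (Polynomial.C (((k : ℝ) + 1) * v) * hermitePoly v k).natDegree
          < (Polynomial.X * hermitePoly v (k + 1)).natDegree := by
        have := Polynomial.natDegree_C_mul_le (((k : ℝ) + 1) * v) (hermitePoly v k)
        omega
      rw [hermitePoly_succ_succ]
      refine ⟨hX.sub_of_left (Polynomial.degree_lt_degree hlt), ?_⟩
      rw [Polynomial.natDegree_sub_eq_left_of_natDegree_lt hlt, hXd]

theorem hermitePoly_monic (v : ℝ) (k : ℕ) : (hermitePoly v k).Monic :=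
  (hermitePoly_monic_natDegree v k).1

theorem hermitePoly_natDegree (v : ℝ) (k : ℕ) : (hermitePoly v k).natDegree = k :=
  (hermitePoly_monic_natDegree v k).2

theorem derivative_hermitePoly (v : ℝ) (k : ℕ) :
    Polynomial.derivative (hermitePoly v (k + 1)) = Polynomial.C ((k : ℝ) + 1) * hermitePoly v k := by
  induction k using Nat.strong_induction_on with
  | _ k ih =>
    match k with
    | 0 => simp [hermitePoly]
    | 1 => simp [hermitePoly]; ring
    | (k + 2) =>
      rw [hermitePoly_succ_succ, Polynomial.derivative_sub, Polynomial.derivative_mul,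
        Polynomial.derivative_C_mul, ih (k + 1) (by omega), ih k (by omega),
        hermitePoly_succ_succ v k]
      simp only [Polynomial.derivative_X, map_add, map_mul, map_one, map_natCast]
      push_cast
      ring

/-- The generating function of the Hermite polynomials. -/
theorem gaussCoeff_eq_hermitePoly (ξ : ℝ) (k : ℕ) :
    gaussCoeff (-1) (2 * ξ) k
      = ((2 ^ k / (k.factorial : ℝ) * (hermitePoly (1 / 2) k).eval ξ : ℝ) : ℂ) := by
  induction k using Nat.strong_induction_on with
  | _ k ih =>
    match k with
    | 0 => simp [hermitePoly]
    | 1 => simp [hermitePoly, gaussCoeff_one]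
    | (k + 2) =>
      have h := gaussCoeff_succ_succ (-1) (2 * ξ) k
      rw [ih (k + 1) (by omega), ih k (by omega)] at h
      have h2 : ((k : ℂ) + 2) ≠ 0 := by exact_mod_cast (k + 1).succ_ne_zero
      refine mul_left_cancel₀ h2 (h.trans ?_)
      rw [hermitePoly_succ_succ]
      norm_cast
      simp only [Polynomial.eval_sub, Polynomial.eval_mul, Polynomial.eval_X, Polynomial.eval_C]
      rw [Nat.factorial_succ (k + 1), Nat.factorial_succ k]
      have h0 : (k.factorial : ℝ) ≠ 0 := by exact_mod_cast k.factorial_ne_zero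
      push_cast
      field_simp
      ring

/-! ### Line integrals of Gaussian exponentials -/

/-- Integration by parts along the line. -/
theorem gaussLine_rec {a : ℝ} (ha : 0 < a) (b : ℝ) (p : ℤ) :
    2 * a * gaussLine a b (p + 1) + b * gaussLine a b p + p * gaussLine a b (p - 1) = 0 := by
  have hi : ∀ q : ℤ, Integrable fun t : ℝ =>
      gaussExp a b (1 + t * Complex.I) * (1 + t * Complex.I) ^ q * Complex.I := fun q =>
    (integrable_gaussExp_line ha b q).mul_const _
  have hd : ∀ t : ℝ, HasDerivAt
      (fun t : ℝ => gaussExp a b (1 + t * Complex.I) * (1 + t * Complex.I) ^ p)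
      (2 * a * (gaussExp a b (1 + t * Complex.I) * (1 + t * Complex.I) ^ (p + 1) * Complex.I)
        + b * (gaussExp a b (1 + t * Complex.I) * (1 + t * Complex.I) ^ p * Complex.I)
        + p * (gaussExp a b (1 + t * Complex.I) * (1 + t * Complex.I) ^ (p - 1) * Complex.I)) t := by
    intro t
    have hw0 : (1 + t * Complex.I : ℂ) ≠ 0 := line_ne_zero (line_re t)
    have h1 : HasDerivAt (fun t : ℝ => (1 + t * Complex.I : ℂ)) Complex.I t := by
      simpa using ((Complex.ofRealCLM.hasDerivAt (x := t)).mul_const Complex.I).const_add 1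
    have h2 := (hasDerivAt_gaussExp a b (1 + t * Complex.I)).comp_of_eq t h1 rfl
    have h3 := (hasDerivAt_zpow p (1 + t * Complex.I : ℂ) (Or.inl hw0)).comp_of_eq t h1 rfl
    refine (h2.mul h3).congr_deriv ?_
    simp only [Function.comp]
    rw [zpow_add_one₀ hw0]
    ring
  have h := integral_eq_zero_of_hasDerivAt_of_integrable hd
    ((((hi (p + 1)).const_mul _).add ((hi p).const_mul _)).add ((hi (p - 1)).const_mul _))
    (integrable_gaussExp_line ha b p)
  have h1 := (hi (p + 1)).const_mul (2 * (a : ℂ))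
  have h2 := (hi p).const_mul (b : ℂ)
  have h3 := (hi (p - 1)).const_mul (p : ℂ)
  have h12 : Integrable fun t : ℝ =>
      2 * (a : ℂ) * (gaussExp a b (1 + t * Complex.I) * (1 + t * Complex.I) ^ (p + 1) * Complex.I)
        + b * (gaussExp a b (1 + t * Complex.I) * (1 + t * Complex.I) ^ p * Complex.I) := h1.add h2
  rw [integral_add h12 h3, integral_add h1 h2, integral_const_mul, integral_const_mul,
    integral_const_mul] at h
  unfold gaussLine lineInt
  linear_combination (1 / twoPiI) * h

theorem gaussLine_zero {a : ℝ} (ha : 0 < a) (b : ℝ) :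
    gaussLine a b 0 = ((1 / (2 * √(π * a)) * Real.exp (-b ^ 2 / (4 * a)) : ℝ) : ℂ) := by
  have h := integral_cexp_quadratic (b := -(a : ℂ)) (by simpa using ha)
    ((2 * a + b) * Complex.I) (a + b)
  have ha' : (a : ℂ) ≠ 0 := by exact_mod_cast ha.ne'
  have e1 : ((a : ℂ) + b) - ((2 * a + b) * Complex.I) ^ 2 / (4 * -(a : ℂ))
      = ((-b ^ 2 / (4 * a) : ℝ) : ℂ) := by
    push_cast
    rw [mul_pow, Complex.I_sq]
    field_simp
    ring
  have e2 : ((π : ℂ) / - -(a : ℂ)) ^ (1 / 2 : ℂ) = ((√(π / a) : ℝ) : ℂ) := by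
    rw [neg_neg, Real.sqrt_eq_rpow, Complex.ofReal_cpow (by positivity)]
    push_cast
    rfl
  rw [e1, e2] at h
  have h3 : lineInt (fun w => gaussExp a b w * w ^ (0 : ℤ))
      = ((√(π / a) : ℝ) : ℂ) * ((Real.exp (-b ^ 2 / (4 * a)) : ℝ) : ℂ) * Complex.I := by
    rw [Complex.ofReal_exp, ← h, lineInt, ← integral_mul_const]
    congr 1
    funext t
    rw [zpow_zero, mul_one, gaussExp]
    congr 2
    linear_combination (a : ℂ) * t ^ 2 * Complex.I_sq
  have h4 : √(π / a) = π / √(π * a) := by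
    rw [Real.sqrt_div Real.pi_pos.le, Real.sqrt_mul Real.pi_pos.le]
    have hp := Real.sqrt_pos.mpr Real.pi_pos
    have hq := Real.sqrt_pos.mpr ha
    field_simp
    rw [Real.sq_sqrt Real.pi_pos.le]
  rw [gaussLine, h3, h4, twoPiI]
  have h5 : ((√(π * a) : ℝ) : ℂ) ≠ 0 := by
    exact_mod_cast (Real.sqrt_pos.mpr (mul_pos Real.pi_pos ha)).ne'
  have h6 : (π : ℂ) ≠ 0 := by exact_mod_cast Real.pi_ne_zero
  have h7 := Complex.I_ne_zero
  push_cast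
  field_simp

/-- The closed form of `(2πi)⁻¹ ∫_L exp (a w² + b w) w ^ m dw` for `m ≥ 0`: a Hermite polynomial
times a Gaussian, in the variable `b`. -/
def gaussHermite (a b : ℝ) (m : ℕ) : ℝ :=
  1 / (2 * √(π * a)) * Real.exp (-b ^ 2 / (4 * a))
    * (hermitePoly (1 / (2 * a)) m).eval (-b / (2 * a))

theorem gaussLine_natCast {a : ℝ} (ha : 0 < a) (b : ℝ) (m : ℕ) :
    gaussLine a b m = (gaussHermite a b m : ℂ) := by
  have ha' : (a : ℂ) ≠ 0 := by exact_mod_cast ha.ne'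
  induction m using Nat.strong_induction_on with
  | _ m ih =>
    match m with
    | 0 =>
      rw [gaussHermite]
      simpa [hermitePoly] using gaussLine_zero ha b
    | 1 =>
      have h := gaussLine_rec ha b 0
      have h0 := ih 0 (by omega)
      simp only [Nat.cast_zero] at h0
      rw [h0] at h
      simp only [zero_add, Int.cast_zero, zero_mul, add_zero] at h
      refine mul_left_cancel₀ (mul_ne_zero two_ne_zero ha') ?_
      rw [Nat.cast_one, ← add_right_cancel_iff (a := (b : ℂ) * (gaussHermite a b 0 : ℂ)), h]
      simp only [gaussHermite, hermitePoly, Polynomial.eval_one, Polynomial.eval_X]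
      norm_cast
      have := ha.ne'
      field_simp
      ring
    | (m + 2) =>
      have h := gaussLine_rec ha b ((m : ℤ) + 1)
      have h0 := ih m (by omega)
      have h1 := ih (m + 1) (by omega)
      rw [add_sub_cancel_right, h0] at h
      push_cast at h h1 ⊢
      rw [h1] at h
      rw [show (m : ℤ) + 2 = m + 1 + 1 by ring]
      refine mul_left_cancel₀ (mul_ne_zero two_ne_zero ha') ?_
      rw [← add_right_cancel_iff (a := (b : ℂ) * (gaussHermite a b (m + 1) : ℂ)
        + ((m : ℂ) + 1) * (gaussHermite a b m : ℂ)), ← add_assoc, h]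
      simp only [gaussHermite, hermitePoly_succ_succ, Polynomial.eval_sub, Polynomial.eval_mul,
        Polynomial.eval_X, Polynomial.eval_C]
      norm_cast
      have := ha.ne'
      field_simp
      ring

/-! ### Gaussian moments -/

theorem hermitePoly_succ (v : ℝ) (m : ℕ) :
    hermitePoly v (m + 1) = Polynomial.X * hermitePoly v m
      - Polynomial.C v * Polynomial.derivative (hermitePoly v m) := by
  cases m with
  | zero => simp [hermitePoly]
  | succ k =>
    rw [hermitePoly_succ_succ, derivative_hermitePoly, ← mul_assoc, ← Polynomial.C_mul,
      mul_comm v]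

theorem hasDerivAt_gaussHermite {a : ℝ} (ha : 0 < a) (b : ℝ) (m : ℕ) :
    HasDerivAt (fun b => gaussHermite a b m) (gaussHermite a b (m + 1)) b := by
  have h1 : HasDerivAt (fun b : ℝ => -b ^ 2 / (4 * a)) (-b / (2 * a)) b := by
    refine (((hasDerivAt_pow 2 b).neg).div_const (4 * a)).congr_deriv ?_
    have := ha.ne'
    push_cast
    field_simp
    ring
  have h2 : HasDerivAt (fun b : ℝ => -b / (2 * a)) (-1 / (2 * a)) b :=
    ((hasDerivAt_id b).neg).div_const (2 * a)
  have h3 := ((hermitePoly (1 / (2 * a)) m).hasDerivAt (-b / (2 * a))).comp_of_eq b h2 rfl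
  refine ((h1.exp.const_mul (1 / (2 * √(π * a)))).mul h3).congr_deriv ?_
  simp only [gaussHermite, hermitePoly_succ, Polynomial.eval_sub, Polynomial.eval_mul,
    Polynomial.eval_X, Polynomial.eval_C, Function.comp]
  ring

theorem integrable_polynomial_mul_exp {b : ℝ} (hb : 0 < b) (c : ℝ) (q : ℝ[X]) :
    Integrable fun s : ℝ => q.eval s * Real.exp (-b * (c - s) ^ 2) := by
  have key : ∀ p : ℝ[X], Integrable fun u : ℝ => p.eval u * Real.exp (-b * u ^ 2) := by
    intro p
    simp only [Polynomial.eval_eq_sum_range, Finset.sum_mul]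
    refine integrable_finsetSum _ fun i _ => ?_
    have h := (integrable_rpow_mul_exp_neg_mul_sq hb
      (lt_of_lt_of_le (by norm_num : (-1 : ℝ) < 0) (Nat.cast_nonneg i))).const_mul (p.coeff i)
    simpa only [Real.rpow_natCast, mul_assoc] using h
  have h := (key (q.comp (Polynomial.C c - Polynomial.X))).comp_sub_left c
  simpa using h

/-- The polynomial in `s`, of degree `m`, by which `gaussHermite a (c - s) m` differs from the
Gaussian `gaussHermite a (c - s) 0`. -/
def shiftedHermite (a c : ℝ) (m : ℕ) : ℝ[X] :=
  (hermitePoly (1 / (2 * a)) m).comp (Polynomial.C (1 / (2 * a)) * (Polynomial.X - Polynomial.C c))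

theorem gaussHermite_sub (a c : ℝ) (m : ℕ) (s : ℝ) :
    gaussHermite a (c - s) m = (shiftedHermite a c m).eval s * gaussHermite a (c - s) 0 := by
  simp only [gaussHermite, shiftedHermite, hermitePoly, Polynomial.eval_comp, Polynomial.eval_mul,
    Polynomial.eval_C, Polynomial.eval_sub, Polynomial.eval_X, Polynomial.eval_one]
  rw [show -(c - s) / (2 * a) = 1 / (2 * a) * (s - c) by ring]
  ring

theorem gaussHermite_zero (a b : ℝ) :
    gaussHermite a b 0 = 1 / (2 * √(π * a)) * Real.exp (-(1 / (4 * a)) * b ^ 2) := by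
  simp only [gaussHermite, hermitePoly, Polynomial.eval_one, mul_one]
  ring_nf

theorem integrable_polynomial_mul_gaussHermite {a : ℝ} (ha : 0 < a) (c : ℝ) (q : ℝ[X]) (m : ℕ) :
    Integrable fun s : ℝ => q.eval s * gaussHermite a (c - s) m := by
  have h := (integrable_polynomial_mul_exp (b := 1 / (4 * a)) (by positivity) c
    (q * shiftedHermite a c m)).const_mul (1 / (2 * √(π * a)))
  refine h.congr (Filter.Eventually.of_forall fun s => ?_)
  simp only [Polynomial.eval_mul]
  rw [gaussHermite_sub, gaussHermite_zero]
  ring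

theorem integrable_pow_mul_gaussHermite {a : ℝ} (ha : 0 < a) (c : ℝ) (l m : ℕ) :
    Integrable fun s : ℝ => s ^ l / (l.factorial : ℝ) * gaussHermite a (c - s) m := by
  have h := integrable_polynomial_mul_gaussHermite ha c
    (Polynomial.C (1 / (l.factorial : ℝ)) * Polynomial.X ^ l) m
  refine h.congr (Filter.Eventually.of_forall fun s => ?_)
  simp only [Polynomial.eval_mul, Polynomial.eval_C, Polynomial.eval_pow, Polynomial.eval_X]
  ring

theorem hasDerivAt_gaussHermite_sub {a : ℝ} (ha : 0 < a) (c : ℝ) (m : ℕ) (s : ℝ) :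
    HasDerivAt (fun s => gaussHermite a (c - s) m) (-gaussHermite a (c - s) (m + 1)) s := by
  have h := (hasDerivAt_gaussHermite ha (c - s) m).comp_of_eq s ((hasDerivAt_id s).const_sub c) rfl
  refine h.congr_deriv ?_
  simp

theorem hasDerivAt_pow_div_factorial (l : ℕ) (s : ℝ) :
    HasDerivAt (fun s : ℝ => s ^ (l + 1) / ((l + 1).factorial : ℝ))
      (s ^ l / (l.factorial : ℝ)) s := by
  refine ((hasDerivAt_pow (l + 1) s).div_const _).congr_deriv ?_
  rw [Nat.factorial_succ]
  have h0 : (l.factorial : ℝ) ≠ 0 := by exact_mod_cast l.factorial_ne_zero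
  have h1 : ((l : ℝ) + 1) ≠ 0 := by exact_mod_cast l.succ_ne_zero
  push_cast
  field_simp

theorem moment_succ_succ {a : ℝ} (ha : 0 < a) (c : ℝ) (l m : ℕ) :
    ∫ s : ℝ, s ^ (l + 1) / ((l + 1).factorial : ℝ) * gaussHermite a (c - s) (m + 1)
      = ∫ s : ℝ, s ^ l / (l.factorial : ℝ) * gaussHermite a (c - s) m := by
  have hd := fun s => (hasDerivAt_pow_div_factorial l s).mul (hasDerivAt_gaussHermite_sub ha c m s)
  have i1 := integrable_pow_mul_gaussHermite ha c (l + 1) (m + 1)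
  have i2 := integrable_pow_mul_gaussHermite ha c l m
  have h := integral_eq_zero_of_hasDerivAt_of_integrable hd
    ((i2.sub i1).congr (Filter.Eventually.of_forall fun s => by simp; ring))
    (integrable_pow_mul_gaussHermite ha c (l + 1) m)
  have h2 := integral_sub i2 i1
  rw [← sub_eq_zero, ← neg_eq_zero, neg_sub, ← h2, ← h]
  congr 1
  funext s
  ring

theorem moment_zero_succ {a : ℝ} (ha : 0 < a) (c : ℝ) (m : ℕ) :
    ∫ s : ℝ, s ^ 0 / ((0).factorial : ℝ) * gaussHermite a (c - s) (m + 1) = 0 := by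
  have i := integrable_pow_mul_gaussHermite ha c 0
  simp only [pow_zero, Nat.factorial_zero, Nat.cast_one, div_one, one_mul] at i ⊢
  have h := integral_eq_zero_of_hasDerivAt_of_integrable
    (fun s => (hasDerivAt_gaussHermite_sub ha c m s).neg)
    ((i (m + 1)).congr (Filter.Eventually.of_forall fun s => by simp)) (i m).neg
  simpa using h

theorem moment_zero_zero {a : ℝ} (ha : 0 < a) (c : ℝ) :
    ∫ s : ℝ, s ^ 0 / ((0).factorial : ℝ) * gaussHermite a (c - s) 0 = 1 := by
  simp only [pow_zero, Nat.factorial_zero, Nat.cast_one, div_one, one_mul, gaussHermite_zero]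
  rw [integral_const_mul,
    integral_sub_left_eq_self (fun s => Real.exp (-(1 / (4 * a)) * s ^ 2)) volume c,
    integral_gaussian]
  rw [show π / (1 / (4 * a)) = 2 ^ 2 * (π * a) by field_simp; ring,
    Real.sqrt_mul (by norm_num : (0 : ℝ) ≤ 2 ^ 2), Real.sqrt_sq (by norm_num)]
  have := (Real.sqrt_pos.mpr (mul_pos Real.pi_pos ha)).ne'
  field_simp

theorem moment_rec {a : ℝ} (ha : 0 < a) (c : ℝ) (l : ℕ) :
    2 * a * ∫ s : ℝ, s ^ l / (l.factorial : ℝ) * gaussHermite a (c - s) 1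
      = ((l : ℝ) + 1) * (∫ s : ℝ, s ^ (l + 1) / ((l + 1).factorial : ℝ) * gaussHermite a (c - s) 0)
        - c * ∫ s : ℝ, s ^ l / (l.factorial : ℝ) * gaussHermite a (c - s) 0 := by
  rw [← integral_const_mul, ← integral_const_mul, ← integral_const_mul, ← integral_sub]
  · congr 1
    funext s
    rw [gaussHermite_sub a c 1, Nat.factorial_succ]
    have h0 : (l.factorial : ℝ) ≠ 0 := by exact_mod_cast l.factorial_ne_zero
    have h1 : ((l : ℝ) + 1) ≠ 0 := by exact_mod_cast l.succ_ne_zero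
    have := ha.ne'
    simp only [shiftedHermite, hermitePoly, Polynomial.X_comp, Polynomial.eval_mul,
      Polynomial.eval_C, Polynomial.eval_sub, Polynomial.eval_X]
    push_cast
    field_simp
    ring
  · exact (integrable_pow_mul_gaussHermite ha c (l + 1) 0).const_mul _
  · exact (integrable_pow_mul_gaussHermite ha c l 0).const_mul _

theorem moment_zero_right {a : ℝ} (ha : 0 < a) (c : ℝ) (l : ℕ) :
    ((∫ s : ℝ, s ^ l / (l.factorial : ℝ) * gaussHermite a (c - s) 0 : ℝ) : ℂ)
      = gaussCoeff a c l := by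
  induction l using Nat.strong_induction_on with
  | _ l ih =>
    match l with
    | 0 => rw [moment_zero_zero ha, gaussCoeff_zero, Complex.ofReal_one]
    | 1 =>
      have h := moment_rec ha c 0
      rw [moment_zero_succ ha, moment_zero_zero ha] at h
      rw [gaussCoeff_one]
      norm_cast
      norm_num at h ⊢
      linarith
    | (l + 2) =>
      have h := moment_rec ha c (l + 1)
      rw [moment_succ_succ ha] at h
      have h' := congrArg (fun x : ℝ => (x : ℂ)) h
      simp only [Complex.ofReal_mul, Complex.ofReal_sub, Complex.ofReal_add] at h'
      rw [ih (l + 1) (by omega), ih l (by omega)] at h'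
      have h2 : ((l : ℂ) + 2) ≠ 0 := by exact_mod_cast (l + 1).succ_ne_zero
      refine mul_left_cancel₀ h2 ?_
      rw [gaussCoeff_succ_succ]
      push_cast at h' ⊢
      linear_combination -h'

/-- The moments of `s ↦ gaussHermite a (c - s) m` are Taylor coefficients of
`exp (a z² + c z)`. -/
theorem moment_eq {a : ℝ} (ha : 0 < a) (c : ℝ) (l m : ℕ) :
    ((∫ s : ℝ, s ^ l / (l.factorial : ℝ) * gaussHermite a (c - s) m : ℝ) : ℂ)
      = if m ≤ l then gaussCoeff a c (l - m) else 0 := by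
  induction m generalizing l with
  | zero => simpa using moment_zero_right ha c l
  | succ m ih =>
    cases l with
    | zero => rw [moment_zero_succ ha]; simp
    | succ l =>
      rw [moment_succ_succ ha, ih]
      simp

/-! ### The Laplace transform on the line -/

theorem integrableOn_pow_mul_exp (l : ℕ) :
    IntegrableOn (fun s : ℝ => s ^ l * Real.exp (-s)) (Set.Ioi 0) := by
  have h := Real.GammaIntegral_convergent (s := (l : ℝ) + 1) (by positivity)
  simpa only [add_sub_cancel_right, Real.rpow_natCast, mul_comm] using h

theorem norm_laplace_integrand {w : ℂ} (hw : w.re = 1) {s : ℝ} (hs : 0 ≤ s) (l : ℕ) :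
    ‖((s ^ l / (l.factorial : ℝ) : ℝ) : ℂ) * Complex.exp (-(s * w))‖
      = (1 / (l.factorial : ℝ)) * (s ^ l * Real.exp (-s)) := by
  rw [norm_mul, Complex.norm_real, Complex.norm_exp, Real.norm_of_nonneg (by positivity)]
  simp only [Complex.neg_re, Complex.re_ofReal_mul, hw, mul_one]
  ring

theorem integrableOn_laplace {w : ℂ} (hw : w.re = 1) (l : ℕ) :
    IntegrableOn (fun s : ℝ => ((s ^ l / (l.factorial : ℝ) : ℝ) : ℂ) * Complex.exp (-(s * w)))
      (Set.Ioi 0) := by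
  refine ((integrableOn_pow_mul_exp l).const_mul (1 / (l.factorial : ℝ))).mono'
    (Continuous.aestronglyMeasurable (by fun_prop)) ?_
  filter_upwards [ae_restrict_mem measurableSet_Ioi] with s hs
  exact (norm_laplace_integrand hw (le_of_lt hs) l).le

theorem laplace_pow {w : ℂ} (hw : w.re = 1) (l : ℕ) :
    ∫ s in Set.Ioi (0 : ℝ), ((s ^ l / (l.factorial : ℝ) : ℝ) : ℂ) * Complex.exp (-(s * w))
      = w ^ (-(l : ℤ) - 1) := by
  have hw0 := line_ne_zero hw
  induction l with
  | zero =>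
    have h := integral_exp_mul_complex_Ioi (a := -w) (by simp [hw]) 0
    simp only [Complex.ofReal_zero, mul_zero, Complex.exp_zero] at h
    rw [show (-1 : ℂ) / -w = w ^ (-((0 : ℕ) : ℤ) - 1) by simp [zpow_neg]] at h
    rw [← h]
    congr 1
    funext s
    rw [show -(s * w) = -w * s by ring]
    simp
  | succ l ih =>
    have hd : ∀ s : ℝ, HasDerivAt (fun s : ℝ => ((s ^ (l + 1) / ((l + 1).factorial : ℝ) : ℝ) : ℂ)
          * Complex.exp (-(s * w)))
        (((s ^ l / (l.factorial : ℝ) : ℝ) : ℂ) * Complex.exp (-(s * w))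
          - w * (((s ^ (l + 1) / ((l + 1).factorial : ℝ) : ℝ) : ℂ)
            * Complex.exp (-(s * w)))) s := by
      intro s
      have h1 := (hasDerivAt_pow_div_factorial l s).ofReal_comp
      have h2 : HasDerivAt (fun s : ℝ => -((s : ℂ) * w)) (-w) s := by
        have h3 := (((hasDerivAt_id (s : ℂ)).comp_ofReal).mul_const w).neg
        rw [one_mul] at h3
        exact h3
      refine (h1.mul h2.cexp).congr_deriv ?_
      ring
    have i1 := integrableOn_laplace hw l
    have i2 := (integrableOn_laplace hw (l + 1)).const_mul w
    have ht : Filter.Tendsto (fun s : ℝ => ((s ^ (l + 1) / ((l + 1).factorial : ℝ) : ℝ) : ℂ)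
          * Complex.exp (-(s * w))) Filter.atTop (nhds 0) := by
      rw [tendsto_zero_iff_norm_tendsto_zero]
      have h := (Real.tendsto_pow_mul_exp_neg_atTop_nhds_zero (l + 1)).const_mul
        (1 / ((l + 1).factorial : ℝ))
      rw [mul_zero] at h
      refine h.congr' ?_
      filter_upwards [Filter.eventually_ge_atTop 0] with s hs
      exact (norm_laplace_integrand hw hs (l + 1)).symm
    have h := integral_Ioi_of_hasDerivAt_of_tendsto' (a := 0) (fun s _ => hd s) (i1.sub i2) ht
    rw [integral_sub i1 i2, ih, integral_const_mul] at h
    simp only [Complex.ofReal_zero, zero_mul, zero_pow (Nat.succ_ne_zero l), zero_div,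
      sub_zero] at h
    have e : w ^ (-(l : ℤ) - 1) = w * w ^ (-((l + 1 : ℕ) : ℤ) - 1) := by
      rw [← zpow_one_add₀ hw0]; push_cast; ring_nf
    rw [sub_eq_zero, e] at h
    exact (mul_left_cancel₀ hw0 h).symm

/-- Line integrals with negative powers of `w` are truncated moments, because
`w ^ (-l - 1)` is the Laplace transform of `s ^ l / l!`. -/
theorem integral_Ioi_gaussHermite {a : ℝ} (ha : 0 < a) (c : ℝ) (l m : ℕ) :
    ((∫ s in Set.Ioi (0 : ℝ), s ^ l / (l.factorial : ℝ) * gaussHermite a (c - s) m : ℝ) : ℂ)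
      = gaussLine a c ((m : ℤ) - l - 1) := by
  set A : ℝ → ℂ := fun t => gaussExp a c (1 + t * Complex.I) * (1 + t * Complex.I) ^ (m : ℤ)
  have hA : Integrable A := integrable_gaussExp_line ha c m
  set F : ℝ → ℝ → ℂ := fun s t => ((s ^ l / (l.factorial : ℝ) : ℝ) : ℂ)
    * Complex.exp (-(s * (1 + t * Complex.I))) * A t with hF
  have hint : Integrable (Function.uncurry F) ((volume.restrict (Set.Ioi 0)).prod volume) := by
    have h := (((integrableOn_pow_mul_exp l).const_mul (1 / (l.factorial : ℝ))).mul_prod hA.norm)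
    refine h.mono' ?_ ?_
    · refine Continuous.aestronglyMeasurable ?_
      have : Continuous A := continuous_gaussExp_line a c m
      simp only [hF]
      fun_prop
    · have h1 : ∀ᵐ q : ℝ × ℝ ∂((volume.restrict (Set.Ioi 0)).prod volume), q.1 ∈ Set.Ioi (0 : ℝ) :=
        Measure.quasiMeasurePreserving_fst.ae (ae_restrict_mem measurableSet_Ioi)
      filter_upwards [h1] with q hq
      simp only [hF, Function.uncurry]
      rw [norm_mul, norm_laplace_integrand (line_re q.2) (le_of_lt hq)]
  have hsw := integral_integral_swap hint
  have hl : ∀ s : ℝ, ∫ t, F s t = ((s ^ l / (l.factorial : ℝ) : ℝ) : ℂ)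
      * (2 * π * (gaussHermite a (c - s) m : ℂ)) := by
    intro s
    rw [← gaussLine_natCast ha, gaussLine, lineInt, integral_mul_const]
    simp only [hF, mul_assoc]
    rw [integral_const_mul]
    congr 1
    have : ∀ t : ℝ, Complex.exp (-(s * (1 + t * Complex.I))) * A t
        = gaussExp a (c - s) (1 + t * Complex.I) * (1 + t * Complex.I) ^ (m : ℤ) := by
      intro t
      simp only [A, gaussExp]
      rw [← mul_assoc, ← Complex.exp_add]
      push_cast
      ring_nf
    simp only [this]
    have h6 : (π : ℂ) ≠ 0 := by exact_mod_cast Real.pi_ne_zero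
    have h7 := Complex.I_ne_zero
    have hq : ∀ Q : ℂ, Q = 2 * (π * (1 / twoPiI * (Q * Complex.I))) := by
      intro Q
      rw [twoPiI]
      field_simp
    exact hq _
  have hr : ∀ t : ℝ, ∫ s in Set.Ioi (0 : ℝ), F s t
      = gaussExp a c (1 + t * Complex.I) * (1 + t * Complex.I) ^ ((m : ℤ) - l - 1) := by
    intro t
    simp only [hF]
    rw [integral_mul_const, laplace_pow (line_re t)]
    simp only [A]
    rw [mul_left_comm, ← zpow_add₀ (line_ne_zero (line_re t))]
    ring_nf
  simp only [hl, hr] at hsw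
  rw [gaussLine, lineInt, integral_mul_const, ← hsw, ← integral_complex_ofReal]
  have h6 : (π : ℂ) ≠ 0 := by exact_mod_cast Real.pi_ne_zero
  have h7 := Complex.I_ne_zero
  rw [← integral_mul_const, ← integral_const_mul]
  congr 1
  funext s
  rw [twoPiI]
  push_cast
  field_simp

/-- The difference between the coefficient and the line integral is an integral over the negative
half-line. -/
theorem gaussCoeff_sub_gaussLine {a : ℝ} (ha : 0 < a) (c : ℝ) (l m : ℕ) :
    (if m ≤ l then gaussCoeff a c (l - m) else 0) - gaussLine a c ((m : ℤ) - l - 1)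
      = ((∫ s in Set.Iic (0 : ℝ), s ^ l / (l.factorial : ℝ) * gaussHermite a (c - s) m : ℝ)
          : ℂ) := by
  have i := integrable_pow_mul_gaussHermite ha c l m
  rw [← moment_eq ha, ← integral_Ioi_gaussHermite ha, ← Complex.ofReal_sub,
    ← intervalIntegral.integral_Iic_add_Ioi i.integrableOn i.integrableOn, add_sub_cancel_right]

/-! ### Positivity of the truncated moment determinant -/

theorem gaussHermite_zero_pos {a : ℝ} (ha : 0 < a) (b : ℝ) : 0 < gaussHermite a b 0 := by
  rw [gaussHermite_zero]
  positivity

theorem shiftedHermite_natDegree {a : ℝ} (ha : 0 < a) (c : ℝ) (m : ℕ) :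
    (shiftedHermite a c m).natDegree = m := by
  have h : (Polynomial.C (1 / (2 * a)) * (Polynomial.X - Polynomial.C c)).natDegree = 1 := by
    rw [Polynomial.natDegree_C_mul (by positivity), Polynomial.natDegree_X_sub_C]
  rw [shiftedHermite, Polynomial.natDegree_comp, h, hermitePoly_natDegree, mul_one]

theorem shiftedHermite_coeff_pos {a : ℝ} (ha : 0 < a) (c : ℝ) (m : ℕ) :
    0 < (shiftedHermite a c m).coeff m := by
  have hne : (1 / (2 * a)) ≠ 0 := by positivity
  have h : (Polynomial.C (1 / (2 * a)) * (Polynomial.X - Polynomial.C c)).natDegree = 1 := by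
    rw [Polynomial.natDegree_C_mul hne, Polynomial.natDegree_X_sub_C]
  have h2 : (shiftedHermite a c m).coeff m = (shiftedHermite a c m).leadingCoeff := by
    rw [Polynomial.leadingCoeff, shiftedHermite_natDegree ha]
  rw [h2, shiftedHermite, Polynomial.leadingCoeff_comp (by rw [h]; norm_num),
    (hermitePoly_monic _ m).leadingCoeff, Polynomial.leadingCoeff_mul, Polynomial.leadingCoeff_C,
    Polynomial.leadingCoeff_X_sub_C]
  positivity

/-- The Gram matrix of the monomials, for a Gaussian weight on the negative half-line, is positive
definite. -/
theorem posDef_gram {a : ℝ} (ha : 0 < a) (c : ℝ) (N : ℕ) :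
    (Matrix.of fun l j : Fin N => ∫ s in Set.Iic (0 : ℝ),
      s ^ (l : ℕ) * s ^ (j : ℕ) * gaussHermite a (c - s) 0).PosDef := by
  have hint : ∀ q : ℝ[X], IntegrableOn (fun s => q.eval s * gaussHermite a (c - s) 0)
      (Set.Iic 0) := fun q => (integrable_polynomial_mul_gaussHermite ha c q 0).integrableOn
  refine Matrix.PosDef.of_dotProduct_mulVec_pos ?_ fun x hx => ?_
  · ext l j
    simp [mul_comm]
  · set q : ℝ[X] := ∑ l : Fin N, Polynomial.C (x l) * Polynomial.X ^ (l : ℕ) with hq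
    have hqe : ∀ s, q.eval s = ∑ l : Fin N, x l * s ^ (l : ℕ) := fun s => by
      simp [hq, Polynomial.eval_finsetSum]
    have hq0 : q ≠ 0 := by
      intro h
      apply hx
      funext i
      have := congrArg (fun p : ℝ[X] => p.coeff i) h
      simpa [hq, Polynomial.finsetSum_coeff, Polynomial.coeff_X_pow, Fin.val_inj] using this
    have hsum : star x ⬝ᵥ (Matrix.of fun l j : Fin N => ∫ s in Set.Iic (0 : ℝ),
        s ^ (l : ℕ) * s ^ (j : ℕ) * gaussHermite a (c - s) 0) *ᵥ x
        = ∫ s in Set.Iic (0 : ℝ), (q * q).eval s * gaussHermite a (c - s) 0 := by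
      have hi : ∀ l j : Fin N, IntegrableOn (fun s : ℝ =>
          x l * (s ^ (l : ℕ) * s ^ (j : ℕ) * gaussHermite a (c - s) 0 * x j)) (Set.Iic 0) := by
        intro l j
        have h := hint (Polynomial.X ^ (l : ℕ) * Polynomial.X ^ (j : ℕ))
        simp only [Polynomial.eval_mul, Polynomial.eval_pow, Polynomial.eval_X] at h
        exact (h.mul_const _).const_mul _
      simp only [dotProduct, Matrix.mulVec, Matrix.of_apply, star_trivial, Finset.mul_sum]
      simp only [← integral_mul_const, ← integral_const_mul]
      rw [← Finset.sum_congr rfl fun l _ => integral_finsetSum _ fun j _ => hi l j,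
        ← integral_finsetSum _ fun l _ => integrable_finsetSum _ fun j _ => hi l j]
      congr 1
      funext s
      rw [Polynomial.eval_mul, hqe, Finset.sum_mul_sum, Finset.sum_mul]
      refine Finset.sum_congr rfl fun l _ => ?_
      rw [Finset.sum_mul]
      exact Finset.sum_congr rfl fun j _ => by ring
    rw [hsum, setIntegral_pos_iff_support_of_nonneg_ae _ (hint _)]
    · have hfin : {s : ℝ | q.IsRoot s}.Finite := Polynomial.finite_setOfPred_isRoot hq0
      have hsub : Set.Ioo (-1 : ℝ) 0 \ {s : ℝ | q.IsRoot s} ⊆ Function.support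
          (fun s => (q * q).eval s * gaussHermite a (c - s) 0) ∩ Set.Iic 0 := by
        rintro s ⟨hs, hsr⟩
        refine ⟨?_, hs.2.le⟩
        have : q.eval s ≠ 0 := hsr
        simp only [Function.mem_support, Polynomial.eval_mul]
        exact mul_ne_zero (mul_ne_zero this this) (gaussHermite_zero_pos ha _).ne'
      refine lt_of_lt_of_le ?_ (measure_mono hsub)
      rw [measure_sdiff_null (hfin.measure_zero _)]
      simp
    · refine Filter.Eventually.of_forall fun s => ?_
      simp only [Polynomial.eval_mul, Pi.zero_apply]
      exact mul_nonneg (mul_self_nonneg _) (gaussHermite_zero_pos ha _).le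

/-- As `gaussHermite a (c - s) m` has degree exactly `m` over the Gaussian, with positive leading
coefficient, the matrix is a Gram matrix times triangular matrices of positive determinant. -/
theorem moment_det_pos {a : ℝ} (ha : 0 < a) (c : ℝ) (N : ℕ) :
    0 < (Matrix.of fun l m : Fin N => ∫ s in Set.Iic (0 : ℝ),
      s ^ (l : ℕ) / ((l : ℕ).factorial : ℝ) * gaussHermite a (c - s) m).det := by
  set G := Matrix.of fun l j : Fin N => ∫ s in Set.Iic (0 : ℝ),
      s ^ (l : ℕ) * s ^ (j : ℕ) * gaussHermite a (c - s) 0 with hG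
  set C := Matrix.of fun m j : Fin N => (shiftedHermite a c m).coeff j with hC
  have hfac : (Matrix.of fun l m : Fin N => ∫ s in Set.Iic (0 : ℝ),
      s ^ (l : ℕ) / ((l : ℕ).factorial : ℝ) * gaussHermite a (c - s) m)
      = Matrix.diagonal (fun l : Fin N => 1 / ((l : ℕ).factorial : ℝ)) * (G * Cᵀ) := by
    ext l m
    rw [Matrix.diagonal_mul, Matrix.mul_apply, Finset.mul_sum]
    simp only [hG, hC, Matrix.of_apply, Matrix.transpose_apply]
    simp only [← integral_mul_const, ← integral_const_mul]
    rw [← integral_finsetSum]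
    · congr 1
      funext s
      rw [gaussHermite_sub, Polynomial.eval_eq_sum_range'
        (by rw [shiftedHermite_natDegree ha]; exact m.2), Finset.sum_range, Finset.sum_mul,
        Finset.mul_sum]
      exact Finset.sum_congr rfl fun j _ => by ring
    · intro j _
      have h := (integrable_polynomial_mul_gaussHermite ha c
        (Polynomial.X ^ (l : ℕ) * Polynomial.X ^ (j : ℕ)) 0).integrableOn (s := Set.Iic 0)
      simp only [Polynomial.eval_mul, Polynomial.eval_pow, Polynomial.eval_X] at h
      exact (h.mul_const _).const_mul _
  have hCdet : C.det = ∏ m : Fin N, (shiftedHermite a c m).coeff m := by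
    refine Matrix.det_of_isLowerTriangular C fun i j hij => ?_
    refine Polynomial.coeff_eq_zero_of_natDegree_lt ?_
    have h := shiftedHermite_natDegree ha c i
    exact h.trans_lt hij
  rw [hfac, Matrix.det_mul, Matrix.det_mul, Matrix.det_diagonal, Matrix.det_transpose, hCdet]
  refine mul_pos (Finset.prod_pos fun l _ => by positivity)
    (mul_pos (posDef_gram ha c N).det_pos
      (Finset.prod_pos fun m _ => shiftedHermite_coeff_pos ha c m))

/-! ### Evaluation of the kernels -/

/-- The form of `loopInt_lineInt` in which all the kernels are evaluated: `F` agrees with the model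
integrand up to a constant, away from the origin. -/
theorem loopInt_lineInt_of_eq (a b : ℝ) (k : ℤ) {a' : ℝ} (ha' : 0 < a') (b' : ℝ) (p : ℤ)
    {F : ℂ → ℂ → ℂ} (c : ℂ)
    (hF : ∀ z w : ℂ, z ≠ 0 → w ≠ 0 →
      F z w = c * (1 / (w - z) * (gaussExp a b z * z ^ k) * (gaussExp a' b' w * w ^ p))) :
    1 / twoPiI ^ 2 * loopInt (fun z => lineInt (F z))
      = c * ∑ m ∈ Finset.range (-k).toNat,
          gaussCoeff a b ((-k).toNat - 1 - m) * gaussLine a' b' (p - m - 1) := by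
  have h1 : loopInt (fun z => lineInt (F z)) = c * loopInt (fun z => lineInt fun w =>
      1 / (w - z) * (gaussExp a b z * z ^ k) * (gaussExp a' b' w * w ^ p)) := by
    have h2 : loopInt (fun z => lineInt (F z)) = loopInt (fun z => c * lineInt fun w =>
        1 / (w - z) * (gaussExp a b z * z ^ k) * (gaussExp a' b' w * w ^ p)) := by
      refine loopInt_congr fun z hz => ?_
      have hz0 : z ≠ 0 := by rintro rfl; norm_num at hz
      rw [lineInt_congr fun w hw => hF z w hz0 (line_ne_zero hw)]
      unfold lineInt
      simp only [mul_assoc]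
      rw [integral_const_mul]
    rw [h2, loopInt, circleIntegral.integral_const_mul, loopInt]
  rw [h1, loopInt_lineInt a b k ha' b' p]
  have := twoPiI_ne_zero
  field_simp

theorem kernelK_eq (β : ℝ) (l k : ℤ) :
    kernelK β l k = ∑ m ∈ Finset.range (-k).toNat,
      gaussCoeff (-2) (4 * β) ((-k).toNat - 1 - m) * gaussLine 2 (-(4 * β)) (-(l + 1) - m - 1) := by
  rw [kernelK, loopInt_lineInt_of_eq (-2) (4 * β) k two_pos (-(4 * β)) (-(l + 1)) 1, one_mul]
  intro z w _ _
  simp only [gaussExp]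
  rw [div_eq_mul_inv (Complex.exp _), ← Complex.exp_neg, div_eq_mul_inv (z ^ k), ← zpow_neg]
  push_cast
  ring_nf

theorem kernelK_eq_zero (β : ℝ) (l : ℤ) {k : ℤ} (hk : 0 ≤ k) : kernelK β l k = 0 := by
  rw [kernelK_eq, show (-k).toNat = 0 by omega]
  simp

/-- At levels `≤ 0` the first integrand of `𝒜` has no pole inside the circle, and only the single
integral remains. -/
theorem funA_of_nonpos (β y : ℝ) (δ : ℕ) (k : ℤ) :
    funA β y (-(δ : ℤ)) k = gaussLine 1 (-(2 * (y + 2 * β))) (δ - k - 1) := by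
  rw [funA, loopInt_lineInt_of_eq (-1) (-(2 * y)) δ two_pos (-(4 * β)) (-(k + 1)) (-1),
    show (-(δ : ℤ)).toNat = 0 by omega]
  · simp only [Finset.range_zero, Finset.sum_empty, mul_zero, zero_add, gaussLine]
    congr 1
    refine lineInt_congr fun w _ => ?_
    simp only [gaussExp]
    rw [div_eq_mul_inv (Complex.exp _), ← zpow_neg]
    push_cast
    ring_nf
  · intro z w _ _
    simp only [gaussExp]
    rw [div_eq_mul_inv (Complex.exp _), ← Complex.exp_neg, div_eq_mul_inv (z ^ _), ← zpow_neg,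
      ← neg_sub w z, one_div, one_div, inv_neg, neg_neg]
    push_cast
    ring_nf

theorem loopInt_gaussExp_zpow (a b : ℝ) (k : ℤ) :
    1 / twoPiI * loopInt (fun z => gaussExp a b z * z ^ k)
      = if k < 0 then gaussCoeff a b (-k - 1).toNat else 0 := by
  have := twoPiI_ne_zero
  split_ifs with h
  · obtain ⟨j, hj⟩ : ∃ j : ℕ, k = -((j : ℤ) + 1) := ⟨(-k - 1).toNat, by omega⟩
    rw [hj, loopInt_gaussExp_of_neg, show (-(-((j : ℤ) + 1)) - 1).toNat = j by omega]
    field_simp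
  · obtain ⟨j, hj⟩ : ∃ j : ℕ, k = j := ⟨k.toNat, by omega⟩
    rw [hj, loopInt_gaussExp_of_nonneg, mul_zero]

theorem funB_eq (β y : ℝ) (u l : ℤ) :
    funB β y u l = -(∑ m ∈ Finset.range (-l).toNat,
        gaussCoeff (-2) (4 * β) ((-l).toNat - 1 - m) * gaussLine 1 (2 * y) (u - m - 1))
      + if u + l < 0 then gaussCoeff (-1) (2 * (y + 2 * β)) (-(u + l) - 1).toNat else 0 := by
  rw [funB, loopInt_lineInt_of_eq (-2) (4 * β) l one_pos (2 * y) u (-1),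
    ← loopInt_gaussExp_zpow]
  · rw [neg_one_mul]
    congr 2
    refine loopInt_congr fun w _ => ?_
    simp only [gaussExp]
    rw [div_eq_mul_inv (w ^ _), ← Complex.exp_neg]
    push_cast
    ring_nf
  · intro z w _ _
    simp only [gaussExp]
    rw [div_eq_mul_inv (Complex.exp _), ← Complex.exp_neg, div_eq_mul_inv (z ^ _), ← zpow_neg,
      ← neg_sub w z, one_div, one_div, inv_neg]
    push_cast
    ring_nf

theorem minorKernel_eq (n : ℤ) (x : ℝ) (n' : ℤ) (x' : ℝ) :
    minorKernel n x n' x' =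
      -(if n' < n then (2 : ℂ) ^ (n - n') * (heaviside (n - n').toNat (x - x') : ℂ) else 0)
      + 2 * ∑ m ∈ Finset.range n.toNat,
          gaussCoeff (-1) (2 * x) (n.toNat - 1 - m) * gaussLine 1 (-(2 * x')) (n' - m - 1) := by
  have h := loopInt_lineInt_of_eq (-1) (2 * x) (-n) one_pos (-(2 * x')) n' (F := fun z w =>
    1 / (w - z) *
        (Complex.exp (-z ^ 2 + 2 * z * x) / Complex.exp (-w ^ 2 + 2 * w * x')) *
        (w ^ n' / z ^ n)) 1 (by
      intro z w _ _
      simp only [gaussExp]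
      rw [div_eq_mul_inv (Complex.exp _), ← Complex.exp_neg, div_eq_mul_inv (w ^ _), ← zpow_neg]
      push_cast
      ring_nf)
  rw [neg_neg, one_mul] at h
  rw [minorKernel, ← h]
  ring

/-! ### The Fredholm determinant -/

/-- The lower unitriangular Toeplitz matrix of the Taylor coefficients of `exp (a z² + b z)`:
the entry `(m, k)` is the coefficient of `z ^ (m - k)`. -/
def toeplitz (a b : ℝ) (N : ℕ) : Matrix (Fin N) (Fin N) ℂ :=
  Matrix.of fun m k => if k ≤ m then gaussCoeff a b ((m : ℕ) - k) else 0

theorem toeplitz_det (a b : ℝ) (N : ℕ) : (toeplitz a b N).det = 1 := by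
  rw [Matrix.det_of_isLowerTriangular]
  · simp [toeplitz]
  · intro i j hij
    have : i < j := hij
    simp [toeplitz, not_le.mpr this]

/-- Products with lower triangular Toeplitz matrices are convolutions. -/
theorem sum_toeplitz {N : ℕ} (a b : ℝ) (k : Fin N) (g : ℕ → ℂ) :
    ∑ m : Fin N, g m * toeplitz a b N m k
      = ∑ i ∈ Finset.range (N - k), g (k + i) * gaussCoeff a b i := by
  have h1 : ∑ m : Fin N, g m * toeplitz a b N m k
      = ∑ m ∈ Finset.range N, if (k : ℕ) ≤ m then g m * gaussCoeff a b (m - k) else 0 := by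
    rw [Finset.sum_range]
    refine Finset.sum_congr rfl fun m _ => ?_
    simp only [toeplitz, Matrix.of_apply, mul_ite, mul_zero]
    rfl
  rw [h1, ← Finset.sum_filter]
  refine Finset.sum_nbij' (fun m => m - k) (fun i => k + i) ?_ ?_ ?_ ?_ ?_
  · intro m hm; simp at hm ⊢; omega
  · intro m hm; simp at hm ⊢; omega
  · intro m hm; simp at hm ⊢; omega
  · intro m hm; simp
  · intro m hm
    simp only [Finset.mem_filter, Finset.mem_range] at hm
    rw [show (k : ℕ) + (m - k) = m by omega]

theorem toeplitz_mul (a b a' b' : ℝ) (N : ℕ) :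
    toeplitz a b N * toeplitz a' b' N = toeplitz (a + a') (b + b') N := by
  ext l k
  rw [Matrix.mul_apply]
  have h := sum_toeplitz a' b' k (fun m => if m ≤ l then gaussCoeff a b ((l : ℕ) - m) else 0)
  have h1 : ∀ m : Fin N, toeplitz a b N l m
      = if (m : ℕ) ≤ l then gaussCoeff a b ((l : ℕ) - m) else 0 := fun m => rfl
  simp only [h1]
  rw [h]
  by_cases hkl : (k : ℕ) ≤ l
  · rw [add_comm a, add_comm b]
    simp only [toeplitz, Matrix.of_apply, Fin.le_def, hkl, if_true, gaussCoeff_add]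
    symm
    refine Finset.sum_subset_zero_on_sdiff ?_ ?_ ?_
    · intro i hi
      simp only [Finset.mem_range] at hi ⊢
      omega
    · intro i hi
      simp only [Finset.mem_sdiff, Finset.mem_range] at hi
      rw [if_neg (by omega), zero_mul]
    · intro i hi
      simp only [Finset.mem_range] at hi
      rw [if_pos (by omega), mul_comm, Nat.sub_sub]
  · have : ¬ (k ≤ l) := hkl
    simp only [toeplitz, Matrix.of_apply, this, if_false]
    refine Finset.sum_eq_zero fun i _ => ?_
    rw [if_neg (by omega), zero_mul]

theorem toeplitz_zero_zero (N : ℕ) : toeplitz 0 0 N = 1 := by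
  ext i j
  rw [toeplitz, Matrix.of_apply, Matrix.one_apply]
  by_cases h : i = j
  · simp [h]
  · rw [if_neg h]
    split_ifs with h2
    · have : (i : ℕ) - j ≠ 0 := by
        have := Fin.val_ne_of_ne h
        have : (j : ℕ) ≤ i := h2
        omega
      rw [gaussCoeff_zero_left]
      simp [this]
    · rfl

/-- The coefficients of the inverse of `exp (-2 z² + 4 β z)` give the inverse Toeplitz matrix, so that
a Toeplitz factor can be taken out of the identity matrix too. -/
theorem one_sub_matK (β : ℝ) (ρ : ℕ) :
    1 - matK β ρ ρ = (toeplitz 2 (-(4 * β)) ρ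
      - Matrix.of fun l m : Fin ρ => gaussLine 2 (-(4 * β)) ((m : ℤ) - l - 1))
        * toeplitz (-2) (4 * β) ρ := by
  rw [sub_mul, toeplitz_mul]
  congr 1
  · rw [← toeplitz_zero_zero]
    congr 1 <;> ring
  · ext l k
    rw [Matrix.mul_apply]
    simp only [Matrix.of_apply]
    rw [sum_toeplitz (-2) (4 * β) k (fun m => gaussLine 2 (-(4 * β)) ((m : ℤ) - l - 1)),
      matK, Matrix.of_apply, kernelK_eq, show (-((k : ℤ) - ρ)).toNat = ρ - k by omega,
      ← Finset.sum_range_reflect]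
    refine Finset.sum_congr rfl fun i hi => ?_
    simp only [Finset.mem_range] at hi
    rw [mul_comm]
    congr 2
    · push_cast [Nat.sub_sub]
      omega
    · omega

theorem fredholmDet_pos (β : ℝ) (ρ : ℕ) :
    ∃ D : ℝ, 0 < D ∧ fredholmDet β ρ = (D : ℂ) := by
  refine ⟨_, moment_det_pos two_pos (-(4 * β)) ρ, ?_⟩
  rw [fredholmDet, one_sub_matK, Matrix.det_mul, toeplitz_det, mul_one]
  have h := Complex.ofRealHom.map_det (Matrix.of fun l m : Fin ρ => ∫ s in Set.Iic (0 : ℝ),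
      s ^ (l : ℕ) / ((l : ℕ).factorial : ℝ) * gaussHermite 2 (-(4 * β) - s) m)
  rw [Complex.ofRealHom_eq_coe] at h
  rw [h]
  congr 1
  ext l m
  exact gaussCoeff_sub_gaussLine two_pos (-(4 * β)) l m

/-! ### The matrix `ℒ` as a differentiation matrix -/

theorem iterate_derivative_X_sub_C_mul (a : ℝ) (q : ℝ[X]) (k : ℕ) :
    Polynomial.derivative^[k + 1] ((Polynomial.X - Polynomial.C a) * q)
      = (Polynomial.X - Polynomial.C a) * Polynomial.derivative^[k + 1] q
        + Polynomial.C ((k : ℝ) + 1) * Polynomial.derivative^[k] q := by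
  induction k with
  | zero => simp; ring
  | succ k ih =>
    rw [Function.iterate_succ_apply', ih, Polynomial.derivative_add, Polynomial.derivative_mul,
      Polynomial.derivative_C_mul, Function.iterate_succ_apply' _ (k + 1),
      Function.iterate_succ_apply' _ k]
    simp only [Polynomial.derivative_sub, Polynomial.derivative_X, Polynomial.derivative_C]
    push_cast
    simp only [map_add, map_one, map_natCast]
    ring

theorem eval_iterate_derivative_X_sub_C_mul (a : ℝ) (q : ℝ[X]) (k : ℕ) :
    (Polynomial.derivative^[k + 1] ((Polynomial.X - Polynomial.C a) * q)).eval a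
      = ((k : ℝ) + 1) * (Polynomial.derivative^[k] q).eval a := by
  rw [iterate_derivative_X_sub_C_mul]
  simp

theorem polyR_eq_nodal {n : ℕ} (β : ℝ) (x : Fin n → ℝ) :
    polyR β x = Lagrange.nodal Finset.univ fun k => x k - β := by
  rw [polyR, Lagrange.nodal_eq]
  refine Finset.prod_congr rfl fun k _ => ?_
  rw [Polynomial.C_sub]
  ring

theorem polyRhat_eq_prod {n : ℕ} (β : ℝ) (x : Fin n → ℝ) {i j : Fin n} :
    polyRhat β x i j = ∏ k ∈ (Finset.univ.erase j).erase i,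
      (Polynomial.X - Polynomial.C (x k - β)) := by
  rw [polyRhat]
  refine Finset.prod_congr ?_ fun k _ => ?_
  · ext k
    simp
  · rw [Polynomial.C_sub]
    ring

/-- The entries of `ℒ` are the `δ`-th derivatives of the Lagrange basis at the nodes. -/
theorem matL_eq_basis {n : ℕ} (β : ℝ) (δ : ℕ) (x : Fin n → ℝ) (hx : Function.Injective x)
    (i j : Fin n) :
    matL β δ x i j = (-1) ^ δ * (Polynomial.derivative^[δ]
      (Lagrange.basis Finset.univ (fun k => x k - β) j)).eval (x i - β) := by
  set v : Fin n → ℝ := fun k => x k - β with hv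
  have hvi : Function.Injective v := fun a b h => hx (by simpa [hv] using h)
  have hbasis : Lagrange.basis Finset.univ v j = Polynomial.C
      (((Polynomial.derivative (polyR β x)).eval (x j - β))⁻¹) *
        Lagrange.nodal (Finset.univ.erase j) v := by
    rw [Lagrange.basis_eq_prod_sub_inv_mul_nodal_div (Finset.mem_univ j),
      Lagrange.nodalWeight_eq_eval_derivative_nodal (Finset.mem_univ j),
      Lagrange.nodal_erase_eq_nodal_div (Finset.mem_univ j), polyR_eq_nodal]
  rw [hbasis, Polynomial.iterate_derivative_C_mul, Polynomial.eval_C_mul, matL, Matrix.of_apply]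
  split_ifs with hij
  · subst hij
    have hR : polyR β x = (Polynomial.X - Polynomial.C (x i - β))
        * Lagrange.nodal (Finset.univ.erase i) v := by
      rw [polyR_eq_nodal, Lagrange.nodal_eq, Lagrange.nodal_eq,
        Finset.mul_prod_erase _ (fun k => Polynomial.X - Polynomial.C (x k - β))
          (Finset.mem_univ i)]
    rw [show (Polynomial.derivative^[δ + 1] (polyR β x)).eval (x i - β)
      = ((δ : ℝ) + 1) * (Polynomial.derivative^[δ]
        (Lagrange.nodal (Finset.univ.erase i) v)).eval (x i - β) by
        rw [hR, eval_iterate_derivative_X_sub_C_mul]]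
    have : ((δ : ℝ) + 1) ≠ 0 := by positivity
    field_simp
  · have hR : Lagrange.nodal (Finset.univ.erase j) v = (Polynomial.X - Polynomial.C (x i - β))
        * polyRhat β x i j := by
      rw [polyRhat_eq_prod, Lagrange.nodal_eq,
        Finset.mul_prod_erase (Finset.univ.erase j)
          (fun k => Polynomial.X - Polynomial.C (x k - β)) (by simp [hij])]
    rw [hR]
    cases δ with
    | zero => simp
    | succ d =>
      rw [eval_iterate_derivative_X_sub_C_mul]
      simp only [Nat.add_sub_cancel]
      push_cast
      ring

/-- In terms of values at the nodes, `ℒ` acts as `(-d/dz)^δ` on polynomials of degree less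
than `n`. -/
theorem sum_matL_mul_eval {n : ℕ} (β : ℝ) (δ : ℕ) (x : Fin n → ℝ) (hx : Function.Injective x)
    (i : Fin n) (p : ℝ[X]) (hp : p.natDegree < n) :
    ∑ j, matL β δ x i j * p.eval (x j - β)
      = (-1) ^ δ * (Polynomial.derivative^[δ] p).eval (x i - β) := by
  have hvi : Function.Injective fun k => x k - β := fun a b h => hx (by simpa using h)
  have hdeg : p.degree < ((Finset.univ : Finset (Fin n)).card : WithBot ℕ) := by
    rw [Finset.card_univ, Fintype.card_fin]
    exact lt_of_le_of_lt Polynomial.degree_le_natDegree (by exact_mod_cast hp)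
  have h := Lagrange.eq_interpolate (s := Finset.univ) (v := fun k => x k - β) (f := p)
    hvi.injOn hdeg
  rw [Lagrange.interpolate_apply] at h
  conv_rhs => rw [h, Polynomial.iterate_derivative_sum, Polynomial.eval_finsetSum, Finset.mul_sum]
  refine Finset.sum_congr rfl fun j _ => ?_
  rw [matL_eq_basis β δ x hx, Polynomial.iterate_derivative_C_mul, Polynomial.eval_C_mul]
  ring

/-- The coefficient of `z ^ k` in `exp (-z² + 2 z ξ)`, as a polynomial in `ξ`. -/
def hermiteCoeff (k : ℕ) : ℝ[X] :=
  Polynomial.C (2 ^ k / (k.factorial : ℝ)) * hermitePoly (1 / 2) k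

theorem derivative_hermiteCoeff (k : ℕ) :
    Polynomial.derivative (hermiteCoeff (k + 1)) = Polynomial.C 2 * hermiteCoeff k := by
  rw [hermiteCoeff, Polynomial.derivative_C_mul, derivative_hermitePoly, hermiteCoeff,
    ← mul_assoc, ← mul_assoc, ← Polynomial.C_mul, ← Polynomial.C_mul, Nat.factorial_succ]
  congr 2
  have h0 : (k.factorial : ℝ) ≠ 0 := by exact_mod_cast k.factorial_ne_zero
  have h1 : ((k : ℝ) + 1) ≠ 0 := by exact_mod_cast k.succ_ne_zero
  push_cast
  field_simp
  ring

theorem iterate_derivative_hermiteCoeff (δ k : ℕ) :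
    Polynomial.derivative^[δ] (hermiteCoeff k)
      = if δ ≤ k then Polynomial.C (2 ^ δ) * hermiteCoeff (k - δ) else 0 := by
  induction δ with
  | zero => simp
  | succ δ ih =>
    rw [Function.iterate_succ_apply', ih]
    by_cases h : δ + 1 ≤ k
    · rw [if_pos h, if_pos (by omega), Polynomial.derivative_C_mul,
        show k - δ = (k - (δ + 1)) + 1 by omega, derivative_hermiteCoeff, ← mul_assoc,
        ← Polynomial.C_mul, pow_succ]
    · rw [if_neg h]
      split_ifs with h2
      · rw [show k - δ = 0 by omega]
        simp [hermiteCoeff, hermitePoly]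
      · simp

theorem iterate_derivative_comp_neg_X (p : ℝ[X]) (δ : ℕ) :
    Polynomial.derivative^[δ] (p.comp (-Polynomial.X))
      = Polynomial.C ((-1) ^ δ) * (Polynomial.derivative^[δ] p).comp (-Polynomial.X) := by
  induction δ with
  | zero => simp
  | succ δ ih =>
    rw [Function.iterate_succ_apply', ih, Polynomial.derivative_C_mul, Polynomial.derivative_comp,
      Function.iterate_succ_apply']
    simp [pow_succ]

/-- The values of the Hermite coefficients at the points `β - x_i`. -/
def hermiteMat {n : ℕ} (β : ℝ) (x : Fin n → ℝ) : Matrix (Fin n) (Fin n) ℝ :=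
  Matrix.of fun i k => (hermiteCoeff k).eval (β - x i)

/-- The matrix with ones at the places `(m, m + δ)`. -/
def shiftMat (n δ : ℕ) : Matrix (Fin n) (Fin n) ℝ :=
  Matrix.of fun m k => if (k : ℕ) = m + δ then 1 else 0

theorem mul_shiftMat_apply {n δ : ℕ} (M : Matrix (Fin n) (Fin n) ℝ) (i k : Fin n) :
    (M * shiftMat n δ) i k = if h : δ ≤ (k : ℕ) then M i ⟨k - δ, by omega⟩ else 0 := by
  rw [Matrix.mul_apply]
  split_ifs with h
  · rw [Finset.sum_eq_single (⟨k - δ, by omega⟩ : Fin n)]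
    · simp [shiftMat, h]
    · intro b _ hb
      have : (k : ℕ) ≠ b + δ := fun h2 => hb (Fin.ext (by simp; omega))
      simp [shiftMat, this]
    · simp
  · refine Finset.sum_eq_zero fun m _ => ?_
    have : (k : ℕ) ≠ m + δ := by omega
    simp [shiftMat, this]

/-- In the Hermite basis `ℒ` becomes a multiple of a shift. -/
theorem matL_mul_hermiteMat {n : ℕ} (β : ℝ) (δ : ℕ) (x : Fin n → ℝ) (hx : Function.Injective x) :
    matL β δ x * hermiteMat β x = (2 : ℝ) ^ δ • (hermiteMat β x * shiftMat n δ) := by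
  ext i k
  rw [Matrix.smul_apply, mul_shiftMat_apply, Matrix.mul_apply]
  have hdeg : ((hermiteCoeff k).comp (-Polynomial.X)).natDegree < n := by
    rw [Polynomial.natDegree_comp, Polynomial.natDegree_neg, Polynomial.natDegree_X, mul_one]
    refine lt_of_le_of_lt (Polynomial.natDegree_C_mul_le _ _) ?_
    rw [hermitePoly_natDegree]
    exact k.2
  have h := sum_matL_mul_eval β δ x hx i _ hdeg
  simp only [Polynomial.eval_comp, Polynomial.eval_neg, Polynomial.eval_X, neg_sub] at h
  simp only [hermiteMat, Matrix.of_apply]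
  rw [h, iterate_derivative_comp_neg_X, Polynomial.eval_C_mul, ← mul_assoc, ← mul_pow,
    iterate_derivative_hermiteCoeff]
  split_ifs with hk
  · simp
  · simp

theorem hermiteMat_eq {n : ℕ} (β : ℝ) (x : Fin n → ℝ) :
    hermiteMat β x = (Matrix.of fun i k : Fin n => (hermitePoly (1 / 2) k).eval (β - x i))
      * Matrix.diagonal fun k : Fin n => (2 ^ (k : ℕ) / ((k : ℕ).factorial : ℝ)) := by
  ext i k
  rw [Matrix.mul_diagonal]
  simp [hermiteMat, hermiteCoeff, mul_comm]

theorem det_hermitePoly {n : ℕ} (v : ℝ) (s : Fin n → ℝ) :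
    (Matrix.of fun i k : Fin n => (hermitePoly v k).eval (s i)).det
      = (Matrix.vandermonde s).det :=
  (Matrix.det_eval_matrixOfPolynomials_eq_det_vandermonde s (fun k => hermitePoly v k)
    (fun k => hermitePoly_natDegree v k) (fun k => hermitePoly_monic v k)).symm

theorem det_hermiteMat_ne_zero {n : ℕ} (β : ℝ) (x : Fin n → ℝ) (hx : Function.Injective x) :
    (hermiteMat β x).det ≠ 0 := by
  rw [hermiteMat_eq, Matrix.det_mul, det_hermitePoly, Matrix.det_diagonal]
  refine mul_ne_zero (Matrix.det_vandermonde_ne_zero_iff.mpr fun a b h => hx (by simpa using h)) ?_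
  exact (Finset.prod_pos fun k _ => by positivity).ne'

theorem matL_eq_conj {n : ℕ} (β : ℝ) (δ : ℕ) (x : Fin n → ℝ) (hx : Function.Injective x) :
    matL β δ x = hermiteMat β x * ((2 : ℝ) ^ δ • shiftMat n δ) * (hermiteMat β x)⁻¹ := by
  have hu : IsUnit (hermiteMat β x).det := (det_hermiteMat_ne_zero β x hx).isUnit
  rw [Matrix.mul_smul, ← matL_mul_hermiteMat β δ x hx, Matrix.mul_nonsing_inv_cancel_right _ _ hu]

theorem rank_shiftMat (ρ δ : ℕ) : (shiftMat (ρ + δ) δ).rank = ρ := by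
  have h : shiftMat (ρ + δ) δ * (shiftMat (ρ + δ) δ)ᵀ
      = Matrix.diagonal fun m : Fin (ρ + δ) => if (m : ℕ) < ρ then (1 : ℝ) else 0 := by
    ext m k
    rw [Matrix.mul_apply, Matrix.diagonal_apply]
    simp only [shiftMat, Matrix.of_apply, Matrix.transpose_apply, ite_mul, one_mul, zero_mul]
    by_cases hm : (m : ℕ) < ρ
    · rw [Finset.sum_eq_single (⟨m + δ, by omega⟩ : Fin (ρ + δ))]
      · by_cases hmk : m = k
        · subst hmk
          simp [hm]
        · have : (m : ℕ) ≠ k := Fin.val_ne_of_ne hmk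
          simp [hmk, this]
      · intro b _ hb
        rw [if_neg fun h2 => hb (Fin.ext h2)]
      · simp
    · rw [Finset.sum_eq_zero fun b _ => ?_]
      · simp [hm]
      · rw [if_neg (by omega)]
  rw [← Matrix.rank_self_mul_transpose, h, Matrix.rank_diagonal]
  have hcard : Fintype.card {m : Fin (ρ + δ) // (if (m : ℕ) < ρ then (1 : ℝ) else 0) ≠ 0}
      = Fintype.card (Fin ρ) := by
    refine Fintype.card_congr
      { toFun := fun m => ⟨m.1, by have := m.2; simpa using this⟩
        invFun := fun k => ⟨Fin.castAdd δ k, by simp⟩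
        left_inv := fun m => by ext; simp
        right_inv := fun k => by ext; simp }
  rw [hcard, Fintype.card_fin]

theorem rank_matL {ρ δ : ℕ} (β : ℝ) (x : Fin (ρ + δ) → ℝ) (hx : Function.Injective x) :
    (matL β δ x).rank = ρ := by
  have hu : IsUnit (hermiteMat β x).det := (det_hermiteMat_ne_zero β x hx).isUnit
  rw [← Matrix.rank_mul_eq_left_of_isUnit_det (hermiteMat β x) _ hu, matL_mul_hermiteMat β δ x hx,
    Matrix.rank_smul_of_mem_nonZeroDivisors _ (mem_nonZeroDivisors_of_ne_zero (by positivity)),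
    Matrix.rank_mul_eq_right_of_isUnit_det _ _ hu, rank_shiftMat]

theorem matL_zero {n : ℕ} (β : ℝ) (x : Fin n → ℝ) (hx : Function.Injective x) :
    matL β 0 x = 1 := by
  have hu : IsUnit (hermiteMat β x).det := (det_hermiteMat_ne_zero β x hx).isUnit
  have h : shiftMat n 0 = 1 := by
    ext i j
    simp [shiftMat, Matrix.one_apply, Fin.ext_iff, eq_comm]
  rw [matL_eq_conj β 0 x hx, h, pow_zero, one_smul, mul_one, Matrix.mul_nonsing_inv _ hu]

theorem trace_matL {n δ : ℕ} (hδ : 1 ≤ δ) (β : ℝ) (x : Fin n → ℝ) (hx : Function.Injective x) :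
    (matL β δ x).trace = 0 := by
  have hu : IsUnit (hermiteMat β x).det := (det_hermiteMat_ne_zero β x hx).isUnit
  rw [matL_eq_conj β δ x hx, Matrix.trace_mul_comm, ← mul_assoc, Matrix.nonsing_inv_mul _ hu,
    one_mul, Matrix.trace_smul]
  have : (shiftMat n δ).trace = 0 := by
    refine Finset.sum_eq_zero fun i _ => ?_
    rw [Matrix.diag_apply, shiftMat, Matrix.of_apply, if_neg (by omega)]
  rw [this, smul_zero]

theorem sum_matL {n δ : ℕ} (hδ : 1 ≤ δ) (β : ℝ) (x : Fin n → ℝ) (hx : Function.Injective x)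
    (i : Fin n) : ∑ j, matL β δ x i j = 0 := by
  have h := sum_matL_mul_eval β δ x hx i 1 (by rw [Polynomial.natDegree_one]; exact i.pos)
  obtain ⟨d, rfl⟩ : ∃ d, δ = d + 1 := ⟨δ - 1, by omega⟩
  simpa [Function.iterate_succ_apply] using h

/-! ### Block structure of the kernel -/

/-- The finite-rank part of the kernel, with the truncation `N` of the resolvent as a parameter. -/
def resolventSum (β : ℝ) (ρ N : ℕ) (u₁ : ℤ) (y₁ : ℝ) (u₂ : ℤ) (y₂ : ℝ) : ℂ :=
  ∑ l : Fin N,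
      ((1 - matK β ρ N)⁻¹ *ᵥ fun k : Fin N => funA β (y₁ - β) u₁ ((k : ℤ) - ρ)) l
        * funB β (y₂ - β) u₂ ((l : ℤ) - ρ)

theorem tacnodeKernel_eq (β : ℝ) {ρ N : ℕ} (u₁ : ℤ) (y₁ : ℝ) (u₂ : ℤ) (y₂ : ℝ)
    (hN : max ρ ((ρ : ℤ) - u₂).toNat = N) :
    tacnodeKernel β ρ u₁ y₁ u₂ y₂ = minorKernel u₁ (β - y₁) u₂ (β - y₂)
      + 2 * resolventSum β ρ N u₁ y₁ u₂ y₂ := by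
  subst hN
  rfl

theorem det_one_sub_matK (β : ℝ) (ρ δ : ℕ) :
    (1 - matK β ρ (ρ + δ)).det = fredholmDet β ρ := by
  have h : (1 - matK β ρ (ρ + δ)).submatrix finSumFinEquiv finSumFinEquiv
      = Matrix.fromBlocks (1 - matK β ρ ρ) 0
        (Matrix.of fun (i : Fin δ) (k : Fin ρ) => -kernelK β (((ρ + i : ℕ) : ℤ) - ρ) ((k : ℤ) - ρ))
        1 := by
    ext i j
    rcases i with i | i <;> rcases j with j | j
    · simp [matK, Matrix.one_apply, Fin.ext_iff]
    · have hne : (i : ℕ) ≠ ρ + j := by omega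
      simp [matK, Fin.ext_iff, hne, kernelK_eq_zero]
    · have hne : ρ + (i : ℕ) ≠ j := by omega
      simp [matK, Fin.ext_iff, hne]
    · simp [matK, Matrix.one_apply, Fin.ext_iff, kernelK_eq_zero]
  rw [← Matrix.det_submatrix_equiv_self finSumFinEquiv, h, Matrix.det_fromBlocks_zero₁₂,
    Matrix.det_one, mul_one, fredholmDet]

theorem fredholmDet_ne_zero (β : ℝ) (ρ : ℕ) : fredholmDet β ρ ≠ 0 := by
  obtain ⟨D, hD, h⟩ := fredholmDet_pos β ρ
  rw [h]
  exact_mod_cast hD.ne'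

/-- Since the columns of `𝒦^β` with nonnegative index vanish, the resolvent may be truncated at
any larger size. -/
theorem resolvent_castAdd (β : ℝ) (ρ δ : ℕ) (a : ℕ → ℂ) (l : Fin ρ) :
    ((1 - matK β ρ (ρ + δ))⁻¹ *ᵥ fun k : Fin (ρ + δ) => a k) (Fin.castAdd δ l)
      = ((1 - matK β ρ ρ)⁻¹ *ᵥ fun k : Fin ρ => a k) l := by
  have hu : IsUnit (1 - matK β ρ ρ).det := (fredholmDet_ne_zero β ρ).isUnit
  have hu' : IsUnit (1 - matK β ρ (ρ + δ)).det := by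
    rw [det_one_sub_matK]
    exact hu
  set v := (1 - matK β ρ (ρ + δ))⁻¹ *ᵥ fun k : Fin (ρ + δ) => a k with hv
  have h1 : (1 - matK β ρ (ρ + δ)) *ᵥ v = fun k : Fin (ρ + δ) => a k := by
    rw [hv, Matrix.mulVec_mulVec, Matrix.mul_nonsing_inv _ hu', Matrix.one_mulVec]
  have h2 : (1 - matK β ρ ρ) *ᵥ (fun l : Fin ρ => v (Fin.castAdd δ l))
      = fun k : Fin ρ => a k := by
    funext l
    have h3 := congrFun h1 (Fin.castAdd δ l)
    rw [Matrix.sub_mulVec, Matrix.one_mulVec, Pi.sub_apply] at h3 ⊢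
    rw [← show a ((Fin.castAdd δ l : Fin (ρ + δ)) : ℕ) = a l by simp, ← h3]
    congr 1
    rw [Matrix.mulVec, Matrix.mulVec, dotProduct, dotProduct, Fin.sum_univ_add]
    rw [Finset.sum_eq_zero (s := (Finset.univ : Finset (Fin δ))), add_zero]
    · rfl
    · intro j _
      simp [matK, kernelK_eq_zero]
  have h4 := congrFun (congrArg (fun w => (1 - matK β ρ ρ)⁻¹ *ᵥ w) h2) l
  simp only [Matrix.mulVec_mulVec] at h4
  rw [Matrix.nonsing_inv_mul _ hu, Matrix.one_mulVec] at h4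
  exact h4

theorem funB_eq_zero (β y : ℝ) {u l : ℤ} (hl : 0 ≤ l) (hul : 0 ≤ u + l) : funB β y u l = 0 := by
  rw [funB_eq, show (-l).toNat = 0 by omega, if_neg (by omega)]
  simp

theorem resolventSum_eq (β : ℝ) (ρ δ : ℕ) (u₁ : ℤ) (y₁ : ℝ) {u₂ : ℤ} (hu₂ : 0 ≤ u₂) (y₂ : ℝ) :
    resolventSum β ρ ρ u₁ y₁ u₂ y₂ = resolventSum β ρ (ρ + δ) u₁ y₁ u₂ y₂ := by
  rw [resolventSum, resolventSum, Fin.sum_univ_add]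
  rw [Finset.sum_eq_zero (s := (Finset.univ : Finset (Fin δ))), add_zero]
  · refine Finset.sum_congr rfl fun l _ => ?_
    rw [resolvent_castAdd β ρ δ (fun k => funA β (y₁ - β) u₁ ((k : ℤ) - ρ)) l]
    simp
  · intro j _
    rw [funB_eq_zero, mul_zero]
    · simp
    · simp
      omega

theorem resolventSum_eq_mul {n : ℕ} (β : ℝ) (ρ : ℕ) (u₁ u₂ : ℤ) (s t : Fin n → ℝ) (i j : Fin n) :
    resolventSum β ρ n u₁ (s i) u₂ (t j)
      = ((Matrix.of fun i k : Fin n => funA β (s i - β) u₁ ((k : ℤ) - ρ))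
          * ((1 - matK β ρ n)⁻¹)ᵀ
          * (Matrix.of fun l j : Fin n => funB β (t j - β) u₂ ((l : ℤ) - ρ))
          : Matrix (Fin n) (Fin n) ℂ) i j := by
  rw [resolventSum, Matrix.mul_apply]
  refine Finset.sum_congr rfl fun l _ => ?_
  rw [Matrix.mul_apply]
  congr 1
  rw [Matrix.mulVec, dotProduct]
  refine Finset.sum_congr rfl fun k _ => ?_
  rw [Matrix.of_apply, Matrix.transpose_apply, mul_comm]

/-- The resolvent factors out of the determinant, because the minor kernel vanishes in the first
block row. -/
theorem det_blocks {n : ℕ} (A₁ A₂ G B₁ B₂ M₂₁ M₂₂ : Matrix (Fin n) (Fin n) ℂ) :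
    (Matrix.fromBlocks ((2 : ℂ) • (A₁ * G * B₁)) ((2 : ℂ) • (A₁ * G * B₂))
      (M₂₁ + (2 : ℂ) • (A₂ * G * B₁)) (M₂₂ + (2 : ℂ) • (A₂ * G * B₂))).det
      = 2 ^ n * A₁.det * G.det * (Matrix.fromBlocks B₁ B₂ M₂₁ M₂₂).det := by
  have h : Matrix.fromBlocks ((2 : ℂ) • (A₁ * G * B₁)) ((2 : ℂ) • (A₁ * G * B₂))
      (M₂₁ + (2 : ℂ) • (A₂ * G * B₁)) (M₂₂ + (2 : ℂ) • (A₂ * G * B₂))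
      = Matrix.fromBlocks ((2 : ℂ) • (A₁ * G)) 0 ((2 : ℂ) • (A₂ * G)) 1
        * Matrix.fromBlocks B₁ B₂ M₂₁ M₂₂ := by
    rw [Matrix.fromBlocks_multiply]
    simp [add_comm]
  rw [h, Matrix.det_mul, Matrix.det_fromBlocks_zero₁₂, Matrix.det_smul, Matrix.det_mul,
    Matrix.det_one, Fintype.card_fin]
  ring

theorem sum_range_eq_toeplitz {ρ n : ℕ} (hρ : ρ ≤ n) (a b : ℝ) (l : Fin n) (g : ℤ → ℂ) :
    ∑ m ∈ Finset.range (-((l : ℤ) - ρ)).toNat,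
        gaussCoeff a b ((-((l : ℤ) - ρ)).toNat - 1 - m) * g (-m)
      = ∑ m : Fin n, (if (m : ℕ) < ρ then g ((m : ℤ) - ρ + 1) else 0) * toeplitz a b n m l := by
  rw [sum_toeplitz a b l (fun m => if m < ρ then g ((m : ℤ) - ρ + 1) else 0),
    show (-((l : ℤ) - ρ)).toNat = ρ - l by omega, ← Finset.sum_range_reflect]
  refine Finset.sum_subset_zero_on_sdiff ?_ ?_ ?_
  · intro i hi
    simp only [Finset.mem_range] at hi ⊢
    omega
  · intro i hi
    simp only [Finset.mem_sdiff, Finset.mem_range] at hi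
    rw [if_neg (by omega), zero_mul]
  · intro i hi
    simp only [Finset.mem_range] at hi
    rw [if_pos (by omega), mul_comm]
    congr 2
    · omega
    · omega

/-- The rows of `ℬ` at level `-δ` after removing a unitriangular factor. -/
theorem funB_lower {ρ δ n : ℕ} (hn : n = ρ + δ) (β y : ℝ) (l : Fin n) :
    funB β (y - β) (-(δ : ℤ)) ((l : ℤ) - ρ)
      = ∑ m : Fin n, toeplitz (-2) (4 * β) n m l *
        (gaussCoeff 1 (-(2 * (β - y))) (n - 1 - m)
          - if (m : ℕ) < ρ then gaussLine 1 (-(2 * (β - y))) ((m : ℤ) - n) else 0) := by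
  have h1 := sum_range_eq_toeplitz (show ρ ≤ n by omega) (-2) (4 * β) l
    (fun q => gaussLine 1 (2 * (y - β)) (-(δ : ℤ) + q - 1))
  have h2 := sum_toeplitz (-2) (4 * β) l (fun m => gaussCoeff 1 (2 * (y - β)) (n - 1 - m))
  have h3 := gaussCoeff_add (-2) (4 * β) 1 (2 * (y - β)) (n - 1 - l)
  have e1 : -(2 * (β - y)) = 2 * (y - β) := by ring
  rw [funB_eq, if_pos (by omega), e1]
  have e2 : ∑ m ∈ Finset.range (-((l : ℤ) - ρ)).toNat,
        gaussCoeff (-2) (4 * β) ((-((l : ℤ) - ρ)).toNat - 1 - m) *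
          gaussLine 1 (2 * (y - β)) (-(δ : ℤ) - m - 1)
      = ∑ m : Fin n, toeplitz (-2) (4 * β) n m l *
        if (m : ℕ) < ρ then gaussLine 1 (2 * (y - β)) ((m : ℤ) - n) else 0 := by
    refine (Eq.trans ?_ h1).trans ?_
    · rfl
    · refine Finset.sum_congr rfl fun m _ => ?_
      rw [mul_comm]
      split_ifs with hm
      · congr 2
        omega
      · rfl
  have e3 : gaussCoeff (-1) (2 * (y - β + 2 * β)) (-(-(δ : ℤ) + ((l : ℤ) - ρ)) - 1).toNat
      = ∑ m : Fin n, toeplitz (-2) (4 * β) n m l * gaussCoeff 1 (2 * (y - β)) (n - 1 - m) := by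
    rw [show (-(-(δ : ℤ) + ((l : ℤ) - ρ)) - 1).toNat = n - 1 - l by omega,
      show (-1 : ℝ) = -2 + 1 by norm_num, show 2 * (y - β + 2 * β) = 4 * β + 2 * (y - β) by ring, h3]
    simp only [mul_comm (toeplitz _ _ _ _ _)]
    rw [h2, show n - 1 - l + 1 = n - l by omega]
    refine Finset.sum_congr rfl fun i _ => ?_
    rw [mul_comm, Nat.sub_sub (n - 1)]
  have e4 : ∀ m : Fin n, toeplitz (-2) (4 * β) n m l *
      (gaussCoeff 1 (2 * (y - β)) (n - 1 - m)
        - if (m : ℕ) < ρ then gaussLine 1 (2 * (y - β)) ((m : ℤ) - n) else 0)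
      = toeplitz (-2) (4 * β) n m l * gaussCoeff 1 (2 * (y - β)) (n - 1 - m)
        - toeplitz (-2) (4 * β) n m l *
          if (m : ℕ) < ρ then gaussLine 1 (2 * (y - β)) ((m : ℤ) - n) else 0 :=
    fun m => mul_sub _ _ _
  simp only [e4, Finset.sum_sub_distrib]
  rw [e2, e3]
  ring

/-- The rows of `ℬ` at level `n` after removing the same unitriangular factor. -/
theorem funB_upper {ρ δ n : ℕ} (hn : n = ρ + δ) (β x : ℝ) (l : Fin n) :
    funB β (x - β) n ((l : ℤ) - ρ)
      = ∑ m : Fin n, toeplitz (-2) (4 * β) n m l *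
        (-if (m : ℕ) < ρ then gaussLine 1 (-(2 * (β - x))) ((m : ℤ) + δ) else 0) := by
  have h1 := sum_range_eq_toeplitz (show ρ ≤ n by omega) (-2) (4 * β) l
    (fun q => gaussLine 1 (2 * (x - β)) ((n : ℤ) + q - 1))
  have e1 : -(2 * (β - x)) = 2 * (x - β) := by ring
  rw [funB_eq, if_neg (by omega), add_zero, e1]
  simp only [mul_neg, Finset.sum_neg_distrib, neg_inj]
  refine (Eq.trans ?_ h1).trans ?_
  · rfl
  · refine Finset.sum_congr rfl fun m _ => ?_
    rw [mul_comm]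
    split_ifs with hm
    · congr 2
      omega
    · rfl

/-! ### Evaluation of the kernel determinant -/

theorem gaussHermite_one (s : ℝ) (k : ℕ) :
    gaussHermite 1 (-(2 * s)) k
      = 1 / (2 * √π) * Real.exp (-s ^ 2) * (hermitePoly (1 / 2) k).eval s := by
  rw [gaussHermite, mul_one, mul_one, mul_one]
  congr 2
  · ring_nf
  · ring

/-- The matrix of the line integrals `(2πi)⁻¹ ∫_L exp (w² - 2 s_i w) w ^ k dw`. -/
def gaussMat {n : ℕ} (s : Fin n → ℝ) : Matrix (Fin n) (Fin n) ℝ :=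
  Matrix.of fun i k => gaussHermite 1 (-(2 * s i)) k

theorem det_gaussMat {n : ℕ} (s : Fin n → ℝ) :
    (gaussMat s).det = (∏ i, 1 / (2 * √π) * Real.exp (-(s i) ^ 2)) * (Matrix.vandermonde s).det := by
  have h : gaussMat s = Matrix.diagonal (fun i => 1 / (2 * √π) * Real.exp (-(s i) ^ 2))
      * Matrix.of fun i k : Fin n => (hermitePoly (1 / 2) k).eval (s i) := by
    ext i k
    rw [Matrix.diagonal_mul, gaussMat, Matrix.of_apply, Matrix.of_apply, gaussHermite_one]
  rw [h, Matrix.det_mul, Matrix.det_diagonal, det_hermitePoly]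

/-- Reversing the columns of a Vandermonde matrix amounts to changing the sign of the nodes. -/
theorem det_submatrix_rev_vandermonde {n : ℕ} (s : Fin n → ℝ) :
    (((Equiv.Perm.sign (Fin.revPerm : Equiv.Perm (Fin n)) : ℤ)) : ℝ) * (Matrix.vandermonde s).det
      = (Matrix.vandermonde fun i => -s i).det := by
  have h : (Matrix.vandermonde s).submatrix id Fin.revPerm = Matrix.projVandermonde 1 s := by
    ext i j
    simp [Matrix.vandermonde_apply, Matrix.projVandermonde_apply]
  rw [← Matrix.det_permute', h, Matrix.det_projVandermonde, Matrix.det_vandermonde]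
  refine Finset.prod_congr rfl fun i _ => Finset.prod_congr rfl fun j _ => ?_
  simp
  ring

theorem det_vandermonde_neg {n : ℕ} (s : Fin n → ℝ) :
    (Matrix.vandermonde fun i => -s i).det
      = (Matrix.vandermonde s).det * ∏ k : Fin n, (-1 : ℝ) ^ (k : ℕ) := by
  rw [← Matrix.det_diagonal, ← Matrix.det_mul]
  congr 1
  ext i j
  rw [Matrix.mul_diagonal, Matrix.vandermonde_apply, Matrix.vandermonde_apply, neg_pow, mul_comm]

theorem shiftMat_mul_apply {n δ : ℕ} (M : Matrix (Fin n) (Fin n) ℂ) (m j : Fin n) :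
    ((shiftMat n δ).map (fun r : ℝ => (r : ℂ)) * M) m j
      = if h : (m : ℕ) + δ < n then M ⟨m + δ, h⟩ j else 0 := by
  rw [Matrix.mul_apply]
  split_ifs with h
  · rw [Finset.sum_eq_single (⟨m + δ, h⟩ : Fin n)]
    · simp [shiftMat]
    · intro b _ hb
      have : (b : ℕ) ≠ m + δ := fun h2 => hb (Fin.ext h2)
      simp [shiftMat, this]
    · simp
  · refine Finset.sum_eq_zero fun b _ => ?_
    have : (b : ℕ) ≠ m + δ := by omega
    simp [shiftMat, this]

theorem map_ofReal_mul {n : ℕ} (A B : Matrix (Fin n) (Fin n) ℝ) :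
    (A * B).map (fun r : ℝ => (r : ℂ)) = A.map (fun r : ℝ => (r : ℂ)) * B.map fun r : ℝ => (r : ℂ) :=
  Matrix.map_mul (f := Complex.ofRealHom)

theorem det_map_ofReal {n : ℕ} (A : Matrix (Fin n) (Fin n) ℝ) :
    (A.map fun r : ℝ => (r : ℂ)).det = ((A.det : ℝ) : ℂ) :=
  (Complex.ofRealHom.map_det A).symm

/-- Elimination of the second block column with the help of `ℒ h = 2 ^ δ h P`. -/
theorem det_eliminate {n : ℕ} (δ : ℕ) (H L P E Jy Jx W : Matrix (Fin n) (Fin n) ℂ)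
    (hH : H.det ≠ 0) (hL : L * H = (2 : ℂ) ^ δ • (H * P)) :
    (Matrix.fromBlocks (E - P * Jy) (-(P * Jx))
      (-((2 : ℂ) ^ (n + δ) • W) + (2 : ℂ) • (H * Jy)) ((2 : ℂ) • (H * Jx))).det
      = (H * E - ((2 : ℂ) ^ n / 2) • (L * W)).det * (2 ^ n * Jx.det) := by
  have h2 : ((2 : ℂ) ^ δ) ≠ 0 := pow_ne_zero _ two_ne_zero
  have hHP : H * P = ((2 : ℂ) ^ δ)⁻¹ • (L * H) := by
    rw [hL, smul_smul, inv_mul_cancel₀ h2, one_smul]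
  have h : Matrix.fromBlocks H ((((2 : ℂ) ^ δ)⁻¹ / 2) • L) 0 1
      * Matrix.fromBlocks (E - P * Jy) (-(P * Jx))
        (-((2 : ℂ) ^ (n + δ) • W) + (2 : ℂ) • (H * Jy)) ((2 : ℂ) • (H * Jx))
      = Matrix.fromBlocks (H * E - ((2 : ℂ) ^ n / 2) • (L * W)) 0
        (-((2 : ℂ) ^ (n + δ) • W) + (2 : ℂ) • (H * Jy)) ((2 : ℂ) • (H * Jx)) := by
    rw [Matrix.fromBlocks_multiply]
    congr 1
    · rw [Matrix.mul_sub, ← Matrix.mul_assoc H P, hHP]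
      simp only [Matrix.mul_add, Matrix.mul_neg, Matrix.smul_mul, Matrix.mul_smul, smul_smul,
        Matrix.mul_assoc]
      have e1 : ((2 : ℂ) ^ (n + δ) * (((2 : ℂ) ^ δ)⁻¹ / 2)) = 2 ^ n / 2 := by
        rw [pow_add]
        field_simp
      have e2 : ((2 : ℂ) * (((2 : ℂ) ^ δ)⁻¹ / 2)) = ((2 : ℂ) ^ δ)⁻¹ := by ring
      rw [e1, e2]
      abel
    · rw [Matrix.mul_neg, ← Matrix.mul_assoc H P, hHP]
      simp only [Matrix.smul_mul, Matrix.mul_smul, smul_smul, Matrix.mul_assoc]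
      have e2 : ((2 : ℂ) * (((2 : ℂ) ^ δ)⁻¹ / 2)) = ((2 : ℂ) ^ δ)⁻¹ := by ring
      rw [e2]
      abel
    · simp
    · simp
  have h3 := congrArg Matrix.det h
  rw [Matrix.det_mul, Matrix.det_fromBlocks_zero₂₁, Matrix.det_one, mul_one,
    Matrix.det_fromBlocks_zero₁₂, Matrix.det_smul, Fintype.card_fin, Matrix.det_mul] at h3
  refine mul_left_cancel₀ hH (h3.trans ?_)
  ring

theorem hermiteMat_map {n : ℕ} (β : ℝ) (x : Fin n → ℝ) (i k : Fin n) :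
    (hermiteMat β x).map (fun r : ℝ => (r : ℂ)) i k = gaussCoeff (-1) (2 * (β - x i)) k := by
  rw [Matrix.map_apply, gaussCoeff_eq_hermitePoly, hermiteMat, Matrix.of_apply, hermiteCoeff,
    Polynomial.eval_C_mul]

/-- Apart from the Heaviside term, the minor kernel depends on a point `x_i` of level `n` through a
row of the Hermite matrix only. -/
theorem minorKernel_levels {n : ℕ} (β : ℝ) (x : Fin n → ℝ) (i : Fin n) (u : ℤ) (t : ℝ) :
    minorKernel n (β - x i) u (β - t)
      = -(if u < n then (2 : ℂ) ^ ((n : ℤ) - u) * (heaviside ((n : ℤ) - u).toNat (t - x i) : ℂ)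
          else 0)
        + 2 * ∑ k : Fin n, (hermiteMat β x).map (fun r : ℝ => (r : ℂ)) i k
          * gaussLine 1 (-(2 * (β - t))) (k + u - n) := by
  rw [minorKernel_eq, Int.toNat_natCast, ← Finset.sum_range_reflect]
  simp only [hermiteMat_map]
  rw [Finset.sum_range fun k => gaussCoeff (-1) (2 * (β - x i)) (n - 1 - (n - 1 - k))
    * gaussLine 1 (-(2 * (β - t))) (u - ((n - 1 - k : ℕ) : ℤ) - 1)]
  congr 1
  · rw [show β - x i - (β - t) = t - x i by ring]
  · congr 1
    refine Finset.sum_congr rfl fun k _ => ?_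
    rw [show n - 1 - (n - 1 - (k : ℕ)) = k by omega,
      show u - ((n - 1 - (k : ℕ) : ℕ) : ℤ) - 1 = k + u - n by omega]

/-- The kernel determinant for any distinct `x_i` and arbitrary `y_j`, up to the evaluation of the
two Vandermonde-type factors. The sign comes from the order of the indices `-ρ, …, δ - 1` of `𝒜`,
which is opposite to that of the powers of `w`. -/
theorem tacnode_det {n ρ δ : ℕ} (hρ : 1 ≤ ρ) (hn : n = ρ + δ) (β : ℝ) (x y : Fin n → ℝ)
    (hx : Function.Injective x) :
    (tacnodeMatrix β ρ
        (Sum.elim (fun _ : Fin n => -(δ : ℤ)) (fun _ : Fin n => (n : ℤ)))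
        (Sum.elim y x)).det
      = ((2 ^ n * 2 ^ n * (2 ^ n / 2) ^ n * ((gaussMat fun i => y i + β).det
          * ((Equiv.Perm.sign (Fin.revPerm : Equiv.Perm (Fin n)) : ℤ) : ℝ))
          * (gaussMat fun i => β - x i).det * gammaXY β δ x y : ℝ) : ℂ) / fredholmDet β ρ := by
  set A₁ : Matrix (Fin n) (Fin n) ℂ :=
    Matrix.of fun i k => funA β (y i - β) (-(δ : ℤ)) ((k : ℤ) - ρ) with hA₁
  set A₂ : Matrix (Fin n) (Fin n) ℂ :=
    Matrix.of fun i k => funA β (x i - β) n ((k : ℤ) - ρ) with hA₂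
  set B₁ : Matrix (Fin n) (Fin n) ℂ :=
    Matrix.of fun l j => funB β (y j - β) (-(δ : ℤ)) ((l : ℤ) - ρ) with hB₁
  set B₂ : Matrix (Fin n) (Fin n) ℂ :=
    Matrix.of fun l j => funB β (x j - β) n ((l : ℤ) - ρ) with hB₂
  set G := ((1 - matK β ρ n)⁻¹)ᵀ with hG
  set H := (hermiteMat β x).map fun r : ℝ => (r : ℂ) with hH
  set L := (matL β δ x).map fun r : ℝ => (r : ℂ) with hL
  set P := (shiftMat n δ).map fun r : ℝ => (r : ℂ) with hP
  set E : Matrix (Fin n) (Fin n) ℂ :=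
    Matrix.of fun m j => gaussCoeff 1 (-(2 * (β - y j))) (n - 1 - m) with hE
  set Jy : Matrix (Fin n) (Fin n) ℂ :=
    Matrix.of fun k j => gaussLine 1 (-(2 * (β - y j))) ((k : ℤ) - δ - n) with hJy
  set Jx : Matrix (Fin n) (Fin n) ℂ :=
    Matrix.of fun k j => gaussLine 1 (-(2 * (β - x j))) k with hJx
  set W : Matrix (Fin n) (Fin n) ℂ :=
    Matrix.of fun k j => ((heaviside (n + δ) (y j - x k) : ℝ) : ℂ) with hW
  set M₂₁ := -((2 : ℂ) ^ (n + δ) • W) + (2 : ℂ) • (H * Jy) with hM₂₁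
  set M₂₂ := (2 : ℂ) • (H * Jx) with hM₂₂
  have hdetK : (1 - matK β ρ n).det = fredholmDet β ρ := by rw [hn, det_one_sub_matK]
  have hsum : ∀ (u₁ : ℤ) (s t : ℝ), resolventSum β ρ ρ u₁ s n t = resolventSum β ρ n u₁ s n t := by
    intro u₁ s t
    have h := resolventSum_eq β ρ δ u₁ s (u₂ := (n : ℤ)) (by omega) t
    rwa [← hn] at h
  -- the four blocks
  have hT : tacnodeMatrix β ρ
        (Sum.elim (fun _ : Fin n => -(δ : ℤ)) (fun _ : Fin n => (n : ℤ))) (Sum.elim y x)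
      = Matrix.fromBlocks ((2 : ℂ) • (A₁ * G * B₁)) ((2 : ℂ) • (A₁ * G * B₂))
      (M₂₁ + (2 : ℂ) • (A₂ * G * B₁)) (M₂₂ + (2 : ℂ) • (A₂ * G * B₂)) := by
    ext i j
    rcases i with i | i <;> rcases j with j | j
    · simp only [tacnodeMatrix, Matrix.of_apply, Sum.elim_inl, Matrix.fromBlocks_apply₁₁,
        Matrix.smul_apply, smul_eq_mul]
      rw [tacnodeKernel_eq (N := n) _ _ _ _ _ (by omega), resolventSum_eq_mul, minorKernel_eq,
        if_neg (by omega), show (-(δ : ℤ)).toNat = 0 by omega]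
      simp [hA₁, hB₁, hG]
    · simp only [tacnodeMatrix, Matrix.of_apply, Sum.elim_inl, Sum.elim_inr,
        Matrix.fromBlocks_apply₁₂, Matrix.smul_apply, smul_eq_mul]
      rw [tacnodeKernel_eq (N := ρ) _ _ _ _ _ (by omega), hsum, resolventSum_eq_mul, minorKernel_eq,
        if_neg (by omega), show (-(δ : ℤ)).toNat = 0 by omega]
      simp [hA₁, hB₂, hG]
    · simp only [tacnodeMatrix, Matrix.of_apply, Sum.elim_inl, Sum.elim_inr,
        Matrix.fromBlocks_apply₂₁, Matrix.add_apply, Matrix.smul_apply, smul_eq_mul]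
      rw [tacnodeKernel_eq (N := n) _ _ _ _ _ (by omega), resolventSum_eq_mul,
        minorKernel_levels β x i, if_pos (by omega),
        show ((n : ℤ) - -(δ : ℤ)) = ((n + δ : ℕ) : ℤ) by push_cast; ring, Int.toNat_natCast,
        zpow_natCast]
      congr 1
    · simp only [tacnodeMatrix, Matrix.of_apply, Sum.elim_inr,
        Matrix.fromBlocks_apply₂₂, Matrix.add_apply, Matrix.smul_apply, smul_eq_mul]
      rw [tacnodeKernel_eq (N := ρ) _ _ _ _ _ (by omega), hsum, resolventSum_eq_mul,
        minorKernel_levels β x i, if_neg (lt_irrefl _), neg_zero, zero_add]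
      congr 1
      rw [hM₂₂, Matrix.smul_apply, Matrix.mul_apply, smul_eq_mul]
      simp only [hJx, Matrix.of_apply]
      congr 1
      refine Finset.sum_congr rfl fun k _ => ?_
      rw [add_sub_cancel_right]
  -- a unitriangular Toeplitz factor comes out of the rows of `ℬ`
  have hB : Matrix.fromBlocks B₁ B₂ M₂₁ M₂₂
      = Matrix.fromBlocks (toeplitz (-2) (4 * β) n)ᵀ 0 0 1
        * Matrix.fromBlocks (E - P * Jy) (-(P * Jx)) M₂₁ M₂₂ := by
    rw [Matrix.fromBlocks_multiply]
    simp only [Matrix.zero_mul, add_zero, zero_add, Matrix.one_mul]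
    congr 1
    · ext l j
      rw [Matrix.mul_apply, hB₁, Matrix.of_apply, funB_lower hn]
      refine Finset.sum_congr rfl fun m _ => ?_
      rw [Matrix.transpose_apply, Matrix.sub_apply, shiftMat_mul_apply]
      congr 2
      by_cases hm : (m : ℕ) < ρ
      · rw [if_pos hm, dif_pos (by omega)]
        simp only [hJy, Matrix.of_apply]
        congr 1
        push_cast
        ring
      · rw [if_neg hm, dif_neg (by omega)]
    · ext l j
      rw [Matrix.mul_apply, hB₂, Matrix.of_apply, funB_upper hn]
      refine Finset.sum_congr rfl fun m _ => ?_
      rw [Matrix.transpose_apply, Matrix.neg_apply, shiftMat_mul_apply]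
      congr 2
      by_cases hm : (m : ℕ) < ρ
      · rw [if_pos hm, dif_pos (by omega)]
        simp only [hJx, Matrix.of_apply]
        push_cast
        rfl
      · rw [if_neg hm, dif_neg (by omega)]
  have hHdet : H.det ≠ 0 := by
    rw [hH, det_map_ofReal]
    exact_mod_cast det_hermiteMat_ne_zero β x hx
  have hLH : L * H = (2 : ℂ) ^ δ • (H * P) := by
    rw [hL, hH, hP, ← map_ofReal_mul, matL_mul_hermiteMat β δ x hx, ← map_ofReal_mul]
    ext i j
    simp
  -- the generating function of the Hermite polynomials turns `H * E` into a power
  have hHE : H * E - ((2 : ℂ) ^ n / 2) • (L * W) = ((2 : ℂ) ^ n / 2) •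
      (Matrix.of fun i j : Fin n => (y j - x i) ^ (n - 1) / ((n - 1).factorial : ℝ)
        - ∑ k, matL β δ x i k * heaviside (n + δ) (y j - x k)).map fun r : ℝ => (r : ℂ) := by
    ext i j
    rw [Matrix.sub_apply, Matrix.smul_apply, Matrix.smul_apply, Matrix.map_apply, Matrix.of_apply,
      Matrix.mul_apply, Matrix.mul_apply]
    simp only [hH, hermiteMat_map]
    simp only [hE, hL, hW, Matrix.of_apply, Matrix.map_apply]
    have h := gaussCoeff_add (-1) (2 * (β - x i)) 1 (-(2 * (β - y j))) (n - 1)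
    rw [show n - 1 + 1 = n by omega, Finset.sum_range, neg_add_cancel, gaussCoeff_zero_left] at h
    rw [← h]
    push_cast
    have h2 : (2 : ℂ) ^ n / 2 = 2 ^ (n - 1) := by
      rw [div_eq_iff two_ne_zero, ← pow_succ, show n - 1 + 1 = n by omega]
    rw [smul_eq_mul, smul_eq_mul, h2,
      show (2 : ℂ) * (β - x i) + -(2 * (β - y j)) = 2 * (y j - x i) by ring, mul_pow]
    ring
  have hdetA₁ : A₁.det = ((((gaussMat fun i => y i + β).det
      * ((Equiv.Perm.sign (Fin.revPerm : Equiv.Perm (Fin n)) : ℤ) : ℝ)) : ℝ) : ℂ) := by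
    have h : A₁ = ((gaussMat fun i => y i + β).submatrix id Fin.revPerm).map
        fun r : ℝ => (r : ℂ) := by
      ext i k
      rw [hA₁, Matrix.of_apply, funA_of_nonpos, Matrix.map_apply, Matrix.submatrix_apply, gaussMat,
        Matrix.of_apply, ← gaussLine_natCast one_pos]
      congr 1
      · simp only [id]
        ring
      · simp only [Fin.revPerm_apply, Fin.val_rev]
        omega
    rw [h, det_map_ofReal, Matrix.det_permute', mul_comm]
  have hdetJx : Jx.det = (((gaussMat fun i => β - x i).det : ℝ) : ℂ) := by
    have h : Jx = ((gaussMat fun i => β - x i)ᵀ).map fun r : ℝ => (r : ℂ) := by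
      ext k j
      rw [hJx, Matrix.of_apply, Matrix.map_apply, Matrix.transpose_apply, gaussMat,
        Matrix.of_apply, ← gaussLine_natCast one_pos]
    rw [h, det_map_ofReal, Matrix.det_transpose]
  have hdetG : G.det = (fredholmDet β ρ)⁻¹ := by
    rw [hG, Matrix.det_transpose, Matrix.det_nonsing_inv, hdetK, Ring.inverse_eq_inv']
  rw [hT, det_blocks, hB, Matrix.det_mul, Matrix.det_fromBlocks_zero₁₂,
    Matrix.det_transpose (toeplitz _ _ _), toeplitz_det, Matrix.det_one, hM₂₁, hM₂₂,
    det_eliminate δ H L P E Jy Jx W hHdet hLH, hHE,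
    Matrix.det_smul, Fintype.card_fin, det_map_ofReal, hdetA₁, hdetJx, hdetG, gammaXY]
  push_cast
  ring

/-! ### The volume of the interlacing cone -/

theorem measurePreserving_snoc {n : ℕ} (α : Fin (n + 1) → Type*) [∀ i, MeasureSpace (α i)]
    [∀ i, SigmaFinite (volume : Measure (α i))] :
    MeasurePreserving (fun p : ((i : Fin n) → α i.castSucc) × α (Fin.last n) =>
      (Fin.snoc p.1 p.2 : (i : Fin (n + 1)) → α i)) volume volume := by
  have hm : Measurable (fun p : ((i : Fin n) → α i.castSucc) × α (Fin.last n) =>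
      (Fin.snoc p.1 p.2 : (i : Fin (n + 1)) → α i)) := by
    refine measurable_pi_lambda _ fun i => ?_
    induction i using Fin.lastCases with
    | last => simpa using measurable_snd
    | cast i => simpa [Function.comp_def] using (measurable_pi_apply i).comp measurable_fst
  refine ⟨hm, ?_⟩
  symm
  rw [volume_pi]
  refine Measure.pi_eq fun s hs => ?_
  have hpre : (fun p : ((i : Fin n) → α i.castSucc) × α (Fin.last n) =>
      (Fin.snoc p.1 p.2 : (i : Fin (n + 1)) → α i)) ⁻¹' (Set.univ.pi s)
      = (Set.univ.pi fun i : Fin n => s i.castSucc) ×ˢ s (Fin.last n) := by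
    ext p
    simp only [Set.mem_preimage, Set.mem_pi, Set.mem_univ, true_imp_iff, Set.mem_prod]
    refine ⟨fun h => ⟨fun i => by simpa using h i.castSucc, by simpa using h (Fin.last n)⟩,
      fun h i => ?_⟩
    induction i using Fin.lastCases with
    | last => simpa using h.2
    | cast i => simpa using h.1 i
  rw [Measure.map_apply hm (MeasurableSet.univ_pi hs), hpre, Measure.volume_eq_prod,
    Measure.prod_prod, volume_pi, Measure.pi_pi, Fin.prod_univ_castSucc]

theorem measurableSet_interlaces {X : Type*} [MeasurableSpace X] {p q : ℕ} {f : X → Fin p → ℝ}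
    {g : X → Fin q → ℝ} (hf : Measurable f) (hg : Measurable g) :
    MeasurableSet {a | Interlaces (f a) (g a)} := by
  simp only [Interlaces, Set.ofPred_forall, Set.ofPred_and]
  exact MeasurableSet.iInter fun i => MeasurableSet.iInter fun j =>
    (MeasurableSet.iInter fun _ => measurableSet_le ((measurable_pi_apply j).comp hg)
      ((measurable_pi_apply i).comp hf)).inter
    (MeasurableSet.iInter fun _ => measurableSet_le ((measurable_pi_apply i).comp hf)
      ((measurable_pi_apply j).comp hg))

theorem measurableSet_cone {n : ℕ} (x : Fin n → ℝ) : MeasurableSet (cone x) := by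
  unfold cone
  simp only [Set.ofPred_forall, Set.ofPred_and]
  refine (MeasurableSet.iInter fun k => MeasurableSet.iInter fun l =>
    MeasurableSet.iInter fun _ => ?_).inter (MeasurableSet.iInter fun k =>
      MeasurableSet.iInter fun _ => ?_)
  · exact measurableSet_interlaces (measurable_pi_apply k) (measurable_pi_apply l)
  · exact measurableSet_interlaces (measurable_pi_apply k) measurable_const

theorem interlaces_iff {n : ℕ} (t : Fin n → ℝ) (x : Fin (n + 1) → ℝ) :
    Interlaces t x ↔ t ∈ Set.univ.pi fun i : Fin n => Set.Icc (x i.castSucc) (x i.succ) := by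
  simp only [Interlaces, Set.mem_pi, Set.mem_univ, true_imp_iff, Set.mem_Icc]
  refine ⟨fun h i => ⟨(h i i.castSucc).1 rfl, (h i i.succ).2 rfl⟩, fun h i j => ⟨fun e => ?_,
    fun e => ?_⟩⟩
  · rw [show j = i.castSucc from Fin.ext e]
    exact (h i).1
  · rw [show j = i.succ from Fin.ext e]
    exact (h i).2

theorem Interlaces.monotone {n : ℕ} {t : Fin n → ℝ} {x : Fin (n + 1) → ℝ} (h : Interlaces t x)
    (hx : Monotone x) : Monotone t := by
  rw [interlaces_iff] at h
  intro i j hij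
  rcases hij.eq_or_lt with rfl | hlt
  · exact le_rfl
  · exact (h i trivial).2.trans ((hx (show i.succ ≤ j.castSucc from hlt)).trans (h j trivial).1)

theorem vandermonde_nonneg {n : ℕ} {x : Fin n → ℝ} (hx : Monotone x) :
    0 ≤ (Matrix.vandermonde x).det := by
  rw [Matrix.det_vandermonde]
  refine Finset.prod_nonneg fun i _ => Finset.prod_nonneg fun j hj => ?_
  exact sub_nonneg.mpr (hx (Finset.mem_Ioi.mp hj).le)

theorem vandermonde_pos {n : ℕ} {x : Fin n → ℝ} (hx : StrictMono x) :
    0 < (Matrix.vandermonde x).det := by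
  rw [Matrix.det_vandermonde]
  refine Finset.prod_pos fun i _ => Finset.prod_pos fun j hj => ?_
  exact sub_pos.mpr (hx (Finset.mem_Ioi.mp hj))

/-- Subtracting consecutive rows of a Vandermonde matrix. -/
theorem det_vandermonde_differences {n : ℕ} (x : Fin (n + 1) → ℝ) :
    (Matrix.of fun i j : Fin n =>
      (x i.succ ^ ((j : ℕ) + 1) - x i.castSucc ^ ((j : ℕ) + 1)) / ((j : ℝ) + 1)).det
      = (Matrix.vandermonde x).det / (n.factorial : ℝ) := by
  set B : Matrix (Fin (n + 1)) (Fin (n + 1)) ℝ := Matrix.of fun i j =>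
    Fin.cases (x 0 ^ (j : ℕ)) (fun i : Fin n => x i.succ ^ (j : ℕ) - x i.castSucc ^ (j : ℕ)) i with hB
  have h1 : (Matrix.vandermonde x).det = B.det := by
    refine Matrix.det_eq_of_forall_row_eq_smul_add_pred (fun _ => 1) (fun j => ?_) fun i j => ?_
    · simp [hB, Matrix.vandermonde_apply]
    · simp [hB, Matrix.vandermonde_apply]
  have h2 : B.det = (Matrix.of fun i j : Fin n =>
      x i.succ ^ ((j : ℕ) + 1) - x i.castSucc ^ ((j : ℕ) + 1)).det := by
    rw [Matrix.det_succ_column_zero, Fin.sum_univ_succ, Finset.sum_eq_zero, add_zero]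
    · simp only [hB, Matrix.of_apply, Fin.cases_zero, Fin.val_zero, pow_zero, one_mul]
      congr 1
    · intro i _
      simp [hB]
  have h3 : (Matrix.of fun i j : Fin n =>
      (x i.succ ^ ((j : ℕ) + 1) - x i.castSucc ^ ((j : ℕ) + 1)) / ((j : ℝ) + 1))
      = (Matrix.of fun i j : Fin n => x i.succ ^ ((j : ℕ) + 1) - x i.castSucc ^ ((j : ℕ) + 1))
        * Matrix.diagonal fun j : Fin n => ((j : ℝ) + 1)⁻¹ := by
    ext i j
    rw [Matrix.mul_diagonal, Matrix.of_apply, Matrix.of_apply, div_eq_mul_inv]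
  have h4 : ∏ j : Fin n, ((j : ℝ) + 1)⁻¹ = ((n.factorial : ℝ))⁻¹ := by
    rw [Finset.prod_inv_distrib, ← Finset.prod_range_add_one_eq_factorial, Finset.prod_range]
    push_cast
    rfl
  rw [h3, Matrix.det_mul, Matrix.det_diagonal, h4, ← h2, ← h1, div_eq_mul_inv]

/-- Integrating a Vandermonde determinant over the vectors interlacing with `x`. -/
theorem setIntegral_vandermonde {n : ℕ} {x : Fin (n + 1) → ℝ} (hx : Monotone x) :
    ∫ t in Set.univ.pi fun i : Fin n => Set.Icc (x i.castSucc) (x i.succ),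
      (Matrix.vandermonde t).det = (Matrix.vandermonde x).det / (n.factorial : ℝ) := by
  rw [← det_vandermonde_differences]
  have hdet : ∀ t : Fin n → ℝ, (Matrix.vandermonde t).det
      = ∑ σ : Equiv.Perm (Fin n), ((Equiv.Perm.sign σ : ℤ) : ℝ) * ∏ i, t i ^ (σ i : ℕ) := by
    intro t
    rw [← Matrix.det_transpose, Matrix.det_apply']
    rfl
  simp only [hdet]
  rw [volume_pi, Measure.restrict_pi_pi, integral_finsetSum]
  · rw [← Matrix.det_transpose, Matrix.det_apply']
    refine Finset.sum_congr rfl fun σ _ => ?_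
    rw [integral_const_mul, integral_fintype_prod_eq_prod (fun i (s : ℝ) => s ^ (σ i : ℕ))]
    congr 1
    refine Finset.prod_congr rfl fun i _ => ?_
    rw [integral_Icc_eq_integral_Ioc,
      ← intervalIntegral.integral_of_le (hx (Fin.castSucc_lt_succ).le), integral_pow]
    rfl
  · intro σ _
    rw [← Measure.restrict_pi_pi, ← volume_pi]
    refine ContinuousOn.integrableOn_compact (isCompact_univ_pi fun i => isCompact_Icc) ?_
    fun_prop

/-- The fibres of the cone over its largest component are cones of the next smaller size, so that the
volume is obtained by integrating Vandermonde determinants. -/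
theorem volume_cone (n : ℕ) (x : Fin (n + 1) → ℝ) (hx : Monotone x) :
    volume (cone x) = ENNReal.ofReal
      ((Matrix.vandermonde x).det / ∏ j ∈ Finset.Icc 1 n, (j.factorial : ℝ)) := by
  induction n with
  | zero =>
    have h : cone x = Set.univ := by
      ext T
      simp only [cone, Set.mem_ofPred_eq, Set.mem_univ, iff_true]
      exact ⟨fun k => k.elim0, fun k => k.elim0⟩
    rw [h]
    simp [volume_pi]
  | succ n ih =>
    have hφ := measurePreserving_snoc (n := n) (fun k : Fin (n + 1) => Fin ((k : ℕ) + 1) → ℝ)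
    have hset : (fun p : ((k : Fin n) → Fin ((k.castSucc : ℕ) + 1) → ℝ)
          × (Fin ((Fin.last n : ℕ) + 1) → ℝ) =>
        (Fin.snoc p.1 p.2 : (k : Fin (n + 1)) → Fin ((k : ℕ) + 1) → ℝ)) ⁻¹' (cone x)
        = {p | p.1 ∈ cone (n := n + 1) p.2 ∧ Interlaces p.2 x} := by
      ext ⟨T, t⟩
      simp only [Set.mem_preimage, cone, Set.mem_ofPred_eq]
      constructor
      · rintro ⟨h1, h2⟩
        refine ⟨⟨fun k l hkl => ?_, fun k hk => ?_⟩, ?_⟩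
        · simpa using h1 k.castSucc l.castSucc hkl
        · have h := h1 k.castSucc (Fin.last n) (by
            have : (k : ℕ) + 2 = n + 1 := hk
            simp only [Fin.val_last, Fin.val_castSucc]
            omega)
          simpa using h
        · have h := h2 (Fin.last n) (by simp)
          simpa using h
      · rintro ⟨⟨h1, h2⟩, h3⟩
        refine ⟨fun k l hkl => ?_, fun k hk => ?_⟩
        · induction l using Fin.lastCases with
          | last =>
            induction k using Fin.lastCases with
            | last => simp at hkl
            | cast k =>
              have h := h2 k (by simp at hkl; omega)
              simpa using h
          | cast l =>
            induction k using Fin.lastCases with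
            | last =>
              have := l.2
              simp at hkl
              omega
            | cast k => simpa using h1 k l hkl
        · induction k using Fin.lastCases with
          | last => simpa using h3
          | cast k =>
            have := k.2
            simp at hk
            omega
    have hmeas : MeasurableSet {p : ((k : Fin n) → Fin ((k : ℕ) + 1) → ℝ) × (Fin (n + 1) → ℝ) |
        p.1 ∈ cone (n := n + 1) p.2 ∧ Interlaces p.2 x} := by
      have h := hφ.measurable (measurableSet_cone x)
      rw [hset] at h
      exact h
    have hv : volume (cone x) = volume {p : ((k : Fin n) → Fin ((k : ℕ) + 1) → ℝ)
        × (Fin (n + 1) → ℝ) | p.1 ∈ cone (n := n + 1) p.2 ∧ Interlaces p.2 x} := by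
      have h := hφ.measure_preimage (measurableSet_cone x).nullMeasurableSet
      rw [hset] at h
      exact h.symm
    set S : Set (Fin (n + 1) → ℝ) :=
      Set.univ.pi fun i : Fin (n + 1) => Set.Icc (x i.castSucc) (x i.succ) with hS
    have hSm : MeasurableSet S := MeasurableSet.univ_pi fun i => measurableSet_Icc
    have hfib : ∀ t : Fin (n + 1) → ℝ, volume ((fun T => (T, t)) ⁻¹'
        {p : ((k : Fin n) → Fin ((k : ℕ) + 1) → ℝ) × (Fin (n + 1) → ℝ) |
          p.1 ∈ cone (n := n + 1) p.2 ∧ Interlaces p.2 x})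
        = S.indicator (fun t => ENNReal.ofReal
          ((Matrix.vandermonde t).det / ∏ j ∈ Finset.Icc 1 n, (j.factorial : ℝ))) t := by
      intro t
      by_cases ht : Interlaces t x
      · rw [Set.indicator_of_mem ((interlaces_iff t x).mp ht), ← ih t (ht.monotone hx)]
        congr 1
        ext T
        simp [ht]
      · rw [Set.indicator_of_notMem fun h => ht ((interlaces_iff t x).mpr h)]
        simp [ht]
    have hpos : 0 < ∏ j ∈ Finset.Icc 1 n, (j.factorial : ℝ) :=
      Finset.prod_pos fun j _ => by positivity
    rw [hv, Measure.volume_eq_prod, Measure.prod_apply_symm hmeas]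
    simp only [hfib]
    rw [lintegral_indicator hSm, ← ofReal_integral_eq_lintegral_ofReal]
    · rw [integral_div, setIntegral_vandermonde hx, Finset.prod_Icc_succ_top (by omega), div_div,
        mul_comm ((n + 1).factorial : ℝ)]
    · refine ContinuousOn.integrableOn_compact (isCompact_univ_pi fun i => isCompact_Icc) ?_
      simp only [Matrix.det_vandermonde]
      fun_prop
    · filter_upwards [ae_restrict_mem hSm] with t ht
      exact div_nonneg (vandermonde_nonneg (((interlaces_iff t x).mpr ht).monotone hx)) hpos.le

theorem coneVol_eq {n : ℕ} (hn : 1 ≤ n) (x : Fin n → ℝ) (hx : Monotone x) :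
    coneVol x = (Matrix.vandermonde x).det / ∏ j ∈ Finset.Icc 1 (n - 1), (j.factorial : ℝ) := by
  obtain ⟨m, rfl⟩ : ∃ m, n = m + 1 := ⟨n - 1, by omega⟩
  rw [coneVol, volume_cone m x hx, ENNReal.toReal_ofReal, Nat.add_sub_cancel]
  exact div_nonneg (vandermonde_nonneg hx) (Finset.prod_nonneg fun j _ => by positivity)

/-! ### The determinant as a density -/

theorem gueDensity_eq {n : ℕ} (x : Fin n → ℝ) :
    gueDensity x * (∏ j ∈ Finset.Icc 1 (n - 1), (j.factorial : ℝ))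
      = (2 : ℝ) ^ ((n : ℝ) ^ 2 / 2) / (2 * π) ^ ((n : ℝ) / 2) * (Matrix.vandermonde x).det ^ 2
        * ∏ i, Real.exp (-(x i) ^ 2) := by
  have hpos : 0 < ∏ j ∈ Finset.Icc 1 (n - 1), (j.factorial : ℝ) :=
    Finset.prod_pos fun j _ => by positivity
  rw [gueDensity]
  field_simp

theorem det_eq_jointDensity {n ρ δ : ℕ} (hρ : 1 ≤ ρ) (hn : n = ρ + δ) (β : ℝ) {D : ℝ}
    (hD : fredholmDet β ρ = (D : ℂ)) (x y : Fin n → ℝ) (hx : StrictMono x) (hy : StrictMono y) :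
    (tacnodeMatrix β ρ
        (Sum.elim (fun _ : Fin n => -(δ : ℤ)) (fun _ : Fin n => (n : ℤ)))
        (Sum.elim y x)).det = (jointDensity β δ D x y : ℂ) := by
  rw [tacnode_det hρ hn β x y hx.injective, hD, ← Complex.ofReal_div, det_gaussMat, det_gaussMat]
  congr 1
  have hn1 : 1 ≤ n := by omega
  have hVx := vandermonde_pos hx
  have hVy := vandermonde_pos hy
  set Vx := (Matrix.vandermonde x).det with hVxdef
  set Vy := (Matrix.vandermonde y).det with hVydef
  set F := ∏ j ∈ Finset.Icc 1 (n - 1), (j.factorial : ℝ) with hF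
  have hFpos : 0 < F := Finset.prod_pos fun j _ => by positivity
  set s : ℝ := ∏ k : Fin n, (-1 : ℝ) ^ (k : ℕ) with hs
  have hss : s * s = 1 := by
    rw [hs, ← Finset.prod_mul_distrib]
    refine Finset.prod_eq_one fun k _ => ?_
    rw [← mul_pow]
    norm_num
  -- the signs of the reversal and of the reflection cancel
  have hyv : (Matrix.vandermonde fun i => y i + β).det * ((Equiv.Perm.sign
      (Fin.revPerm : Equiv.Perm (Fin n)) : ℤ) : ℝ) = Vy * s := by
    rw [mul_comm, det_submatrix_rev_vandermonde, det_vandermonde_neg, Matrix.det_vandermonde_add]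
  have hxv : (Matrix.vandermonde fun i => β - x i).det = Vx * s := by
    have h : (fun i => β - x i) = fun i => -(x i - β) := by
      funext i
      ring
    rw [h, det_vandermonde_neg fun i => x i - β, Matrix.det_vandermonde_sub]
  have gx := gueDensity_eq fun i => x i - β
  have gy := gueDensity_eq fun i => y i + β
  rw [Matrix.det_vandermonde_sub] at gx
  rw [Matrix.det_vandermonde_add] at gy
  have ex : ∏ i, Real.exp (-(x i - β) ^ 2) = ∏ i, Real.exp (-(β - x i) ^ 2) :=
    Finset.prod_congr rfl fun i _ => by ring_nf
  set c : ℝ := (2 : ℝ) ^ ((n : ℝ) ^ 2 / 2) / (2 * π) ^ ((n : ℝ) / 2) with hc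
  have hcc : c * c = 2 ^ n * 2 ^ n * (2 ^ n / 2) ^ n * ((1 / (2 * √π)) ^ n * (1 / (2 * √π)) ^ n) := by
    have h1 : (2 : ℝ) ^ ((n : ℝ) ^ 2 / 2) * (2 : ℝ) ^ ((n : ℝ) ^ 2 / 2) = (2 ^ n) ^ n := by
      rw [← Real.rpow_add two_pos, add_halves,
        show (n : ℝ) ^ 2 = ((n * n : ℕ) : ℝ) by push_cast; ring, Real.rpow_natCast, pow_mul]
    have h2 : (2 * π) ^ ((n : ℝ) / 2) * (2 * π) ^ ((n : ℝ) / 2) = (2 * π) ^ n := by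
      rw [← Real.rpow_add (by positivity), add_halves, Real.rpow_natCast]
    have h3 : √π * √π = π := Real.mul_self_sqrt Real.pi_pos.le
    rw [hc, div_mul_div_comm, h1, h2, ← mul_pow, ← mul_pow, ← mul_pow, ← mul_pow, ← div_pow]
    congr 1
    rw [div_mul_div_comm, mul_mul_mul_comm, h3]
    field_simp
  rw [jointDensity, coneVol_eq hn1 x hx.monotone, coneVol_eq hn1 y hy.monotone, ← hVxdef,
    ← hVydef, ← hF]
  have gx' : gueDensity (fun i => x i - β) = c * Vx ^ 2 * (∏ i, Real.exp (-(β - x i) ^ 2)) / F := by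
    rw [eq_div_iff hFpos.ne', gx, ex]
  have gy' : gueDensity (fun i => y i + β) = c * Vy ^ 2 * (∏ i, Real.exp (-(y i + β) ^ 2)) / F := by
    rw [eq_div_iff hFpos.ne', gy]
  rw [gx', gy', Finset.prod_mul_distrib, Finset.prod_mul_distrib, Finset.prod_const,
    Finset.card_univ, Fintype.card_fin, hxv]
  set Ex := ∏ i, Real.exp (-(β - x i) ^ 2)
  set Ey := ∏ i, Real.exp (-(y i + β) ^ 2)
  set g := gammaXY β δ x y
  set q := (1 / (2 * √π)) ^ n with hq
  have e1 : q * Ey * (Matrix.vandermonde fun i => y i + β).det * ((Equiv.Perm.sign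
      (Fin.revPerm : Equiv.Perm (Fin n)) : ℤ) : ℝ) = q * Ey * (Vy * s) := by
    rw [mul_assoc, hyv]
  rw [e1]
  have e2 : 2 ^ n * 2 ^ n * (2 ^ n / 2) ^ n * (q * Ey * (Vy * s)) * (q * Ex * (Vx * s)) * g / D
      = (2 ^ n * 2 ^ n * (2 ^ n / 2) ^ n * (q * q)) * (s * s) * (Ex * Ey * Vx * Vy * g) / D := by
    ring
  rw [e2, ← hcc, hss]
  field_simp

/-! ### The joint density -/

theorem volume_diagonal_eq_zero : volume {z : Fin 2 → ℝ | z 0 = z 1} = 0 := by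
  have h := Measure.addHaar_submodule (volume : Measure (Fin 2 → ℝ))
    (LinearMap.eqLocus (LinearMap.proj (R := ℝ) (φ := fun _ : Fin 2 => ℝ) 0) (LinearMap.proj 1)) (by
      intro htop
      have : (![0, 1] : Fin 2 → ℝ) ∈ (⊤ : Submodule ℝ (Fin 2 → ℝ)) := trivial
      rw [← htop, LinearMap.mem_eqLocus] at this
      simp at this)
  exact h

/-- Two particles on the same level never coincide, because the correlation functions are densities
with respect to Lebesgue measure. -/
theorem IsEdgeTacnodeProcess.strictMono {Ω : Type*} [MeasurableSpace Ω] {β : ℝ} {ρ : ℕ}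
    {μ : Measure Ω} {Z : (u : ℤ) → Ω → Fin (levelSize ρ u) → ℝ}
    (hZ : IsEdgeTacnodeProcess β ρ μ Z) (v : ℤ) : ∀ᵐ ω ∂μ, StrictMono (Z v ω) := by
  have hne : ∀ i j : Fin (levelSize ρ v), i ≠ j → ∀ᵐ ω ∂μ, Z v ω i ≠ Z v ω j := by
    intro i j hij
    set f : (Fin 2 → ℝ) → ℝ≥0∞ := {z : Fin 2 → ℝ | z 0 = z 1}.indicator 1 with hf
    have hfm : Measurable f := measurable_one.indicator
      (measurableSet_eq_fun (measurable_pi_apply 0) (measurable_pi_apply 1))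
    have hc := hZ.correlation 2 (fun _ => v) f hfm
    have h0 : ∫⁻ z : Fin 2 → ℝ, f z * ENNReal.ofReal (tacnodeMatrix β ρ (fun _ => v) z).det.re
        = 0 := by
      rw [← lintegral_zero (μ := (volume : Measure (Fin 2 → ℝ)))]
      refine lintegral_congr_ae ?_
      have : ∀ᵐ z : Fin 2 → ℝ, z ∉ {z : Fin 2 → ℝ | z 0 = z 1} :=
        measure_eq_zero_iff_ae_notMem.mp volume_diagonal_eq_zero
      filter_upwards [this] with z hz
      have h : f z = 0 := Set.indicator_of_notMem (s := {z : Fin 2 → ℝ | z 0 = z 1}) hz 1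
      rw [h, zero_mul]
    rw [h0] at hc
    have hset : MeasurableSet {ω | Z v ω i = Z v ω j} :=
      measurableSet_eq_fun ((measurable_pi_apply i).comp (hZ.measurable v))
        ((measurable_pi_apply j).comp (hZ.measurable v))
    have hle : μ {ω | Z v ω i = Z v ω j} ≤ 0 := by
      rw [← lintegral_indicator_one hset, ← hc]
      refine lintegral_mono fun ω => ?_
      by_cases hω : Z v ω i = Z v ω j
      · have hinj : Function.Injective fun k : Fin 2 =>
            (⟨v, ![i, j] k⟩ : (v : ℤ) × Fin (levelSize ρ v)) := by
          intro k l hkl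
          have h : ![i, j] k = ![i, j] l := by simpa using hkl
          fin_cases k <;> fin_cases l <;> simp_all
        refine le_trans ?_ (Finset.single_le_sum (fun _ _ => zero_le)
          (Finset.mem_univ (![i, j] : (k : Fin 2) → Fin (levelSize ρ v))))
        rw [if_pos hinj, hf, Set.indicator_of_mem (by simpa using hω),
          Set.indicator_of_mem (by simpa using hω)]
        simp
      · rw [Set.indicator_of_notMem (by simpa using hω)]
        exact zero_le
    have h := measure_eq_zero_iff_ae_notMem.mp (le_antisymm hle (zero_le))
    filter_upwards [h] with ω hω using hω
  have hall : ∀ᵐ ω ∂μ, ∀ i j : Fin (levelSize ρ v), i ≠ j → Z v ω i ≠ Z v ω j := by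
    rw [ae_all_iff]
    intro i
    rw [ae_all_iff]
    intro j
    by_cases hij : i = j
    · exact Filter.Eventually.of_forall fun ω h => absurd hij h
    · filter_upwards [hne i j hij] with ω hω _ using hω
  filter_upwards [hall, hZ.ordered v] with ω h1 h2
  exact h2.strictMono_of_injective fun i j h => by
    by_contra hij
    exact h1 i j hij h

theorem strictMono_fin_eq_id {n : ℕ} {g : Fin n → Fin n} (hg : StrictMono g) : g = id := by
  refine (StrictMono.range_inj hg strictMono_id).mp ?_
  rw [Set.range_id, (Finite.surjective_of_injective hg.injective).range_eq]

theorem apply_cast_congr {ρ n : ℕ} {Ω : Type*} (Z : (u : ℤ) → Ω → Fin (levelSize ρ u) → ℝ)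
    {v w : ℤ} (h : v = w) (hv : n = levelSize ρ v) (hw : n = levelSize ρ w) (ω : Ω) (i : Fin n) :
    Z v ω (Fin.cast hv i) = Z w ω (Fin.cast hw i) := by
  subst h
  rfl

theorem measurableSet_strictMono_pair (n : ℕ) :
    MeasurableSet {p : (Fin n → ℝ) × (Fin n → ℝ) | StrictMono p.1 ∧ StrictMono p.2} := by
  have h : MeasurableSet {x : Fin n → ℝ | StrictMono x} := by
    simp only [StrictMono, Set.ofPred_forall]
    exact MeasurableSet.iInter fun i => MeasurableSet.iInter fun j =>
      MeasurableSet.iInter fun _ => measurableSet_lt (measurable_pi_apply i) (measurable_pi_apply j)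
  exact (measurable_fst h).inter (measurable_snd h)

/-- The correlation function of `2n` points, `n` on each of the two levels, tested against the
indicator of the increasing configurations: the sum over labellings has a single nonzero term. -/
theorem joint_density {n ρ δ : ℕ} (hρ : 1 ≤ ρ) (hn : n = ρ + δ) (β : ℝ) {D : ℝ}
    (hD : fredholmDet β ρ = (D : ℂ)) {Ω : Type*} [MeasurableSpace Ω] (μ : Measure Ω)
    (Z : (u : ℤ) → Ω → Fin (levelSize ρ u) → ℝ) (hZ : IsEdgeTacnodeProcess β ρ μ Z) :
    μ.map (fun ω =>
        ((fun i : Fin n => Z n ω (Fin.cast (levelSize_upper hn).symm i)),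
          (fun i : Fin n => Z (-(δ : ℤ)) ω (Fin.cast (levelSize_lower hρ hn).symm i))))
      = ((volume : Measure ((Fin n → ℝ) × (Fin n → ℝ))).restrict
          {p | StrictMono p.1 ∧ StrictMono p.2}).withDensity
          (fun p => ENNReal.ofReal (jointDensity β δ D p.1 p.2)) := by
  set XY : Ω → (Fin n → ℝ) × (Fin n → ℝ) := fun ω =>
        ((fun i : Fin n => Z n ω (Fin.cast (levelSize_upper hn).symm i)),
          (fun i : Fin n => Z (-(δ : ℤ)) ω (Fin.cast (levelSize_lower hρ hn).symm i))) with hXY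
  set Q : Set ((Fin n → ℝ) × (Fin n → ℝ)) := {p | StrictMono p.1 ∧ StrictMono p.2} with hQ
  have hQm : MeasurableSet Q := measurableSet_strictMono_pair n
  have hXYm : Measurable XY := by
    refine Measurable.prodMk ?_ ?_
    · exact measurable_pi_lambda _ fun i => (measurable_pi_apply _).comp (hZ.measurable n)
    · exact measurable_pi_lambda _ fun i => (measurable_pi_apply _).comp (hZ.measurable (-(δ : ℤ)))
  set e : Fin n ⊕ Fin n ≃ Fin (n + n) := finSumFinEquiv with he
  set lv : Fin n ⊕ Fin n → ℤ := Sum.elim (fun _ => (n : ℤ)) (fun _ => -(δ : ℤ)) with hlv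
  set u : Fin (n + n) → ℤ := fun k => lv (e.symm k) with hu
  have hlvs : ∀ a, n = levelSize ρ (lv a) := by
    rintro (a | a)
    · exact (levelSize_upper hn).symm
    · exact (levelSize_lower hρ hn).symm
  have hus : ∀ k, n = levelSize ρ (u k) := fun k => hlvs _
  set idx : Fin (n + n) → Fin n := fun k => Sum.elim id id (e.symm k) with hidx
  -- the pair of vectors encoded in a configuration of `2n` points
  set Φ : (Fin (n + n) → ℝ) → (Fin n → ℝ) × (Fin n → ℝ) := fun z =>
    (fun i => z (e (Sum.inl i)), fun i => z (e (Sum.inr i))) with hΦ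
  have hΦm : Measurable Φ := by
    refine Measurable.prodMk ?_ ?_
    · exact measurable_pi_lambda _ fun i => measurable_pi_apply _
    · exact measurable_pi_lambda _ fun i => measurable_pi_apply _
  set i₀ : (k : Fin (n + n)) → Fin (levelSize ρ (u k)) := fun k => Fin.cast (hus k) (idx k) with hi₀
  have hi₀inj : Function.Injective
      fun k => (⟨u k, i₀ k⟩ : (v : ℤ) × Fin (levelSize ρ v)) := by
    intro k l hkl
    have h1 : u k = u l := congrArg Sigma.fst hkl
    have h2 : ((i₀ k : Fin _) : ℕ) = (i₀ l : Fin _) :=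
      congrArg (fun s : (v : ℤ) × Fin (levelSize ρ v) => (s.2 : ℕ)) hkl
    obtain ⟨a, rfl⟩ := e.surjective k
    obtain ⟨b, rfl⟩ := e.surjective l
    simp only [hu, hi₀, hidx, Fin.val_cast, Equiv.symm_apply_apply] at h1 h2
    rcases a with a | a <;> rcases b with b | b
    · have : a = b := Fin.ext h2
      rw [this]
    · simp only [hlv, Sum.elim_inl, Sum.elim_inr] at h1
      omega
    · simp only [hlv, Sum.elim_inl, Sum.elim_inr] at h1
      omega
    · have : a = b := Fin.ext h2
      rw [this]
  have hΦ₀ : ∀ ω, Φ (fun k => Z (u k) ω (i₀ k)) = XY ω := by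
    intro ω
    refine Prod.ext (funext fun i => ?_) (funext fun i => ?_)
    · have hk : u (e (Sum.inl i)) = n := by simp [hu, hlv]
      have hi : idx (e (Sum.inl i)) = i := by simp [hidx]
      simp only [hΦ, hXY, hi₀]
      rw [apply_cast_congr Z hk (hus _) (levelSize_upper hn).symm, hi]
    · have hk : u (e (Sum.inr i)) = -(δ : ℤ) := by simp [hu, hlv]
      have hi : idx (e (Sum.inr i)) = i := by simp [hidx]
      simp only [hΦ, hXY, hi₀]
      rw [apply_cast_congr Z hk (hus _) (levelSize_lower hρ hn).symm, hi]
  -- only the identity labelling lists the particles of each level in increasing order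
  have huniq : ∀ ω, (∀ v, Monotone (Z v ω)) → ∀ i : (k : Fin (n + n)) → Fin (levelSize ρ (u k)),
      Φ (fun k => Z (u k) ω (i k)) ∈ Q → i = i₀ := by
    intro ω hmono i hi
    have hside : ∀ (v : ℤ) (hv : n = levelSize ρ v) (ι : Fin n → Fin (n + n))
        (hι : ∀ a, u (ι a) = v) , StrictMono (fun a => Z (u (ι a)) ω (i (ι a))) →
        ∀ a, ((i (ι a) : Fin _) : ℕ) = a := by
      intro v hv ι hι hs a
      set g : Fin n → Fin n := fun a => Fin.cast (hus (ι a)).symm (i (ι a)) with hg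
      have hZg : ∀ a, Z (u (ι a)) ω (i (ι a)) = Z v ω (Fin.cast hv (g a)) := fun a => by
        rw [← apply_cast_congr Z (hι a) (hus (ι a)) hv]
        rfl
      have hgs : StrictMono g := by
        intro a b hab
        have h := hs hab
        simp only [hZg] at h
        exact (hmono v).reflect_lt h
      have h2 := congrFun (strictMono_fin_eq_id hgs) a
      exact congrArg Fin.val h2
    funext k
    obtain ⟨a, rfl⟩ := e.surjective k
    refine Fin.ext ?_
    rcases a with a | a
    · have h := hside n (levelSize_upper hn).symm (fun a => e (Sum.inl a))
        (fun a => by simp [hu, hlv]) hi.1 a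
      rw [h]
      simp [hi₀, hidx]
    · have h := hside (-(δ : ℤ)) (levelSize_lower hρ hn).symm (fun a => e (Sum.inr a))
        (fun a => by simp [hu, hlv]) hi.2 a
      rw [h]
      simp [hi₀, hidx]
  have hmono : ∀ᵐ ω ∂μ, ∀ v, Monotone (Z v ω) := ae_all_iff.mpr hZ.ordered
  have hXYQ : ∀ᵐ ω ∂μ, XY ω ∈ Q := by
    filter_upwards [hZ.strictMono n, hZ.strictMono (-(δ : ℤ))] with ω h1 h2
    exact ⟨h1.comp (Fin.cast_strictMono _), h2.comp (Fin.cast_strictMono _)⟩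
  have hdet : ∀ p ∈ Q, ∀ z, Φ z = p →
      (tacnodeMatrix β ρ u z).det = (jointDensity β δ D p.1 p.2 : ℂ) := by
    rintro p hp z rfl
    rw [← det_eq_jointDensity hρ hn β hD _ _ hp.1 hp.2,
      ← Matrix.det_submatrix_equiv_self (e.symm.trans (Equiv.sumComm _ _))
        (tacnodeMatrix β ρ (Sum.elim _ _) (Sum.elim _ _))]
    congr 1
    ext k l
    obtain ⟨a, rfl⟩ := e.surjective k
    obtain ⟨b, rfl⟩ := e.surjective l
    rcases a with a | a <;> rcases b with b | b <;> simp [tacnodeMatrix, hu, hlv, hΦ]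
  ext S hS
  set T := S ∩ Q with hT
  have hTm : MeasurableSet T := hS.inter hQm
  set f : (Fin (n + n) → ℝ) → ℝ≥0∞ := fun z => T.indicator 1 (Φ z) with hf
  have hfm : Measurable f := (measurable_one.indicator hTm).comp hΦm
  have hc := hZ.correlation (n + n) u f hfm
  have hleft : ∀ᵐ ω ∂μ, (∑ i : (k : Fin (n + n)) → Fin (levelSize ρ (u k)),
        open Classical in
        if Function.Injective (fun k => (⟨u k, i k⟩ : (v : ℤ) × Fin (levelSize ρ v)))
        then f (fun k => Z (u k) ω (i k)) else 0) = (XY ⁻¹' T).indicator 1 ω := by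
    filter_upwards [hmono] with ω hω
    rw [Finset.sum_eq_single i₀, if_pos hi₀inj, hf]
    · simp only [hΦ₀]
      rfl
    · intro i _ hi
      have h0 : f (fun k => Z (u k) ω (i k)) = 0 :=
        Set.indicator_of_notMem (fun h => hi (huniq ω hω i h.2)) _
      rw [h0, ite_self]
    · intro h
      exact absurd (Finset.mem_univ _) h
  rw [lintegral_congr_ae hleft, lintegral_indicator_one (hXYm hTm)] at hc
  have hmap : μ.map XY S = μ (XY ⁻¹' T) := by
    rw [Measure.map_apply hXYm hS]
    refine measure_congr ?_
    filter_upwards [hXYQ] with ω hω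
    exact propext ⟨fun h => ⟨h, hω⟩, fun h => h.1⟩
  -- transport of the integral over `2n` points to pairs of vectors
  set Ψ : (Fin n → ℝ) × (Fin n → ℝ) ≃ᵐ (Fin (n + n) → ℝ) :=
    (MeasurableEquiv.sumPiEquivProdPi fun _ : Fin n ⊕ Fin n => ℝ).symm.trans
      (MeasurableEquiv.piCongrLeft (fun _ => ℝ) e) with hΨ
  have hΨmp : MeasurePreserving Ψ volume volume :=
    (volume_measurePreserving_piCongrLeft (fun _ : Fin (n + n) => ℝ) e).comp
      (volume_measurePreserving_sumPiEquivProdPi_symm fun _ : Fin n ⊕ Fin n => ℝ)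
  have hΦΨ : ∀ p, Φ (Ψ p) = p := by
    intro p
    refine Prod.ext (funext fun i => ?_) (funext fun i => ?_)
    · exact MeasurableEquiv.piCongrLeft_apply_apply (β := fun _ => ℝ) e _ (Sum.inl i)
    · exact MeasurableEquiv.piCongrLeft_apply_apply (β := fun _ => ℝ) e _ (Sum.inr i)
  rw [hmap, hc, ← hΨmp.lintegral_comp_emb Ψ.measurableEmbedding, withDensity_apply _ hS,
    Measure.restrict_restrict hS, ← hT, ← lintegral_indicator hTm]
  refine lintegral_congr fun p => ?_
  by_cases hp : p ∈ T
  · rw [Set.indicator_of_mem hp, hdet p hp.2 _ (hΦΨ p)]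
    simp only [hf, hΦΨ]
    rw [Set.indicator_of_mem hp]
    simp
  · rw [Set.indicator_of_notMem hp]
    simp only [hf, hΦΨ]
    rw [Set.indicator_of_notMem hp, zero_mul]

end EdgeTacnode

end

open EdgeTacnode

theorem theorem6p1 (β : ℝ) (hβ : 0 ≤ β) (n ρ δ : ℕ) (hρ : 1 ≤ ρ) (hn : n = ρ + δ) :
    -- the determinant in the denominator is a positive real number `D`
    (∃ D : ℝ, 0 < D ∧ fredholmDet β ρ = (D : ℂ) ∧
      -- evaluation of the `2n × 2n` kernel determinant at levels `-δ` and `n`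
      (∀ x y : Fin n → ℝ, StrictMono x → StrictMono y →
        (tacnodeMatrix β ρ
            (Sum.elim (fun _ : Fin n => -(δ : ℤ)) (fun _ : Fin n => (n : ℤ)))
            (Sum.elim y x)).det = (jointDensity β δ D x y : ℂ)) ∧
      -- joint density of `x^{(n)} = z^{(n)}` and `y^{(n)} = z^{(-δ)}`
      (∀ {Ω : Type*} [MeasurableSpace Ω] (μ : Measure Ω) [IsProbabilityMeasure μ]
        (Z : (u : ℤ) → Ω → Fin (levelSize ρ u) → ℝ), IsEdgeTacnodeProcess β ρ μ Z →
        μ.map (fun ω =>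
            ((fun i : Fin n => Z n ω (Fin.cast (levelSize_upper hn).symm i)),
             (fun i : Fin n => Z (-(δ : ℤ)) ω (Fin.cast (levelSize_lower hρ hn).symm i))))
          = ((volume : Measure ((Fin n → ℝ) × (Fin n → ℝ))).restrict
              {p | StrictMono p.1 ∧ StrictMono p.2}).withDensity
              (fun p => ENNReal.ofReal (jointDensity β δ D p.1 p.2)))) ∧
    -- properties of the matrix `ℒ`
    (∀ x : Fin n → ℝ, Function.Injective x →
      (matL β δ x).rank = ρ ∧
      (δ = 0 → matL β δ x = 1) ∧
      (1 ≤ δ → (matL β δ x).trace = 0 ∧ ∀ i, ∑ j, matL β δ x i j = 0)) := by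
  obtain ⟨D, hD, hDeq⟩ := fredholmDet_pos β ρ
  refine ⟨⟨D, hD, hDeq, det_eq_jointDensity hρ hn β hDeq, ?_⟩, fun x hx => ⟨?_, ?_, ?_⟩⟩
  · intro Ω _ μ _ Z hZ
    exact joint_density hρ hn β hDeq μ Z hZ
  · subst hn
    exact rank_matL β x hx
  · rintro rfl
    exact matL_zero β x hx
  · exact fun hδ => ⟨trace_matL hδ β x hx, sum_matL hδ β x hx⟩
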